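/- Let $p\ge 1$ and let $k>0$. Let $SO(p)$ carry the bi-invariant Riemannian metric given at the identity by $g_{SO}(A_1,A_2)=-\tfrac12\operatorname{tr}(A_1A_2)$, with geodesic distance $d_{SO}$. Let $\mathrm{Diag}^+(p)$, the set of $p\times p$ diagonal matrices with positive diagonal entries, carry the metric $g_{\mathcal D^+}|_D(L_1,L_2)=\operatorname{tr}(D^{-1}L_1D^{-1}L_2)$. Let $M(p)=SO(p)\times\mathrm{Diag}^+(p)$ carry the product metric $k\,g_{SO}\oplus g_{\mathcal D^+}$, with geodesic distance $d_M$ (the infimum of the lengths of piecewise-smooth curves joining two points). Let $F(U,D)=UDU^T$ for $(U,D)\in M(p)$. For symmetric positive-definite $X,Y$ put $d_{SR}(X,Y)=\inf\{d_M(x,y): x\in F^{-1}(X),\ y\in F^{-1}(Y)\}$. A pair of points $(x,y)\in M(p)\times M(p)$ is called *minimal* if there is a piecewise-smooth curve in $M(p)$ from $x$ to $y$ whose length equals $d_{SR}(F(x),F(y))$. A pair $(U,V)\in SO(p)\times SO(p)$ is called *sign-change reducible* if $d_{SO}(US,V)<d_{SO}(U,V)$ for some diagonal matrix $S$ with diagonal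 entries $\pm1$ and $\det S=1$. For a permutation $\pi$ of $\{1,\dots,p\}$ and $\Lambda=\mathrm{diag}(\lambda_1,\dots,\lambda_p)$ put $\pi\cdot\Lambda=\mathrm{diag}(\lambda_{\pi^{-1}(1)},\dots,\lambda_{\pi^{-1}(p)})$. **Proposition.** Suppose that $(U,V)\in SO(p)\times SO(p)$ is not sign-change reducible. Then there exist $D,\Lambda\in\mathrm{Diag}^+(p)$, each with pairwise distinct diagonal entries, such that $((U,D),(V,\Lambda))$ is a minimal pair. Moreover, $D$ and $\Lambda$ can be chosen such that, in addition, for every permutation $\pi\neq\mathrm{id}$ and every $V'\in SO(p)$ with $F(V',\pi\cdot\Lambda)=F(V,\Lambda)$, the pair $((U,D),(V',\pi\cdot\Lambda))$ is not minimal. -/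

import Mathlib

open Set MeasureTheory
open scoped ENNReal ContDiff Matrix

/- The Frobenius norm is put on matrices.  It serves only to speak of derivatives and smoothness
of curves of matrices (any other norm gives the same notions). -/
attribute [local instance] Matrix.frobeniusNormedAddCommGroup Matrix.frobeniusNormedSpace

namespace ScalingRotation

/-! ### Riemannian distance on a subset of a normed space -/

section Riemannian

/-- The restriction of `c` to `[0,1]` is a piecewise-smooth curve. -/
def PiecewiseSmooth {E : Type*} [NormedAddCommGroup E] [NormedSpace ℝ E] (c : ℝ → E) : Prop :=
  ContinuousOn c (Icc 0 1) ∧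
    ∃ (n : ℕ) (τ : ℕ → ℝ), Monotone τ ∧ τ 0 = 0 ∧ τ n = 1 ∧
      ∀ i < n, ContDiffOn ℝ ∞ c (Icc (τ i) (τ (i + 1)))

/-- Piecewise-smooth curves `[0,1] → S`, where `S` is a (sub)manifold in `E`. -/
def CurveIn {E : Type*} [NormedAddCommGroup E] [NormedSpace ℝ E] (S : Set E) (c : ℝ → E) : Prop :=
  PiecewiseSmooth c ∧ ∀ t ∈ Icc (0 : ℝ) 1, c t ∈ S

/-- The length `∫₀¹ g_{c(t)}(c'(t), c'(t))^{1/2} dt` of a curve, where `g x v w` is the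
metric tensor at the point `x` applied to the vectors `v` and `w`. -/
noncomputable def curveLength {E : Type*} [NormedAddCommGroup E] [NormedSpace ℝ E]
    (g : E → E → E → ℝ) (c : ℝ → E) : ℝ≥0∞ :=
  ∫⁻ t in Icc (0 : ℝ) 1, ENNReal.ofReal (Real.sqrt (g (c t) (deriv c t) (deriv c t)))

/-- The Riemannian (geodesic) distance in `S`: the infimum of the lengths of the piecewise-smooth
curves in `S` from `x` to `y`. -/
noncomputable def geodesicDist {E : Type*} [NormedAddCommGroup E] [NormedSpace ℝ E]
    (S : Set E) (g : E → E → E → ℝ) (x y : E) : ℝ≥0∞ :=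
  ⨅ (c : ℝ → E) (_ : CurveIn S c ∧ c 0 = x ∧ c 1 = y), curveLength g c

end Riemannian

/-! ### The manifolds `SO(p)`, `Diag⁺(p)`, `M(p)` and their metrics -/

/-- Real `p × p` matrices. -/
abbrev Mat (p : ℕ) : Type := Matrix (Fin p) (Fin p) ℝ

/-- `SO(p)`. -/
def SO (p : ℕ) : Set (Mat p) := {U | U ∈ Matrix.specialOrthogonalGroup (Fin p) ℝ}

/-- `Diag⁺(p)`: diagonal matrices with positive diagonal entries. -/
def DiagPos (p : ℕ) : Set (Mat p) := {D | D.IsDiag ∧ ∀ i, 0 < D i i}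

/-- The top stratum of `Diag⁺(p)`: the diagonal entries are pairwise distinct. -/
def DiagTop (p : ℕ) : Set (Mat p) := {D | D ∈ DiagPos p ∧ Function.Injective fun i => D i i}

/-- `M(p) = SO(p) × Diag⁺(p)`. -/
def M (p : ℕ) : Set (Mat p × Mat p) := SO p ×ˢ DiagPos p

/-- The bi-invariant metric of `SO(p)` that is `-tr(A₁ A₂)/2` at the identity. -/
noncomputable def metricSO {p : ℕ} (U A₁ A₂ : Mat p) : ℝ :=
  -(1 / 2) * Matrix.trace ((U⁻¹ * A₁) * (U⁻¹ * A₂))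

/-- The invariant metric of `Diag⁺(p)`. -/
noncomputable def metricDiag {p : ℕ} (D L₁ L₂ : Mat p) : ℝ :=
  Matrix.trace (D⁻¹ * L₁ * D⁻¹ * L₂)

/-- The product metric on `M(p)` with parameter `k`. -/
noncomputable def metricM {p : ℕ} (k : ℝ) (x v w : Mat p × Mat p) : ℝ :=
  k * metricSO x.1 v.1 w.1 + metricDiag x.2 v.2 w.2

/-- The geodesic distance of `SO(p)`. -/
noncomputable def dSO {p : ℕ} (U V : Mat p) : ℝ≥0∞ := geodesicDist (SO p) metricSO U V

/-- The geodesic distance of `M(p)`. -/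
noncomputable def dM {p : ℕ} (k : ℝ) (x y : Mat p × Mat p) : ℝ≥0∞ :=
  geodesicDist (M p) (metricM k) x y

/-! ### The eigen-composition map, scaling-rotation distance and minimal pairs -/

/-- The eigen-composition map `F(U,D) = U D Uᵀ`. -/
def F {p : ℕ} (x : Mat p × Mat p) : Mat p := x.1 * x.2 * x.1ᵀ

/-- The fiber of `F : M(p) → Sym⁺(p)` over `X`. -/
def fiber {p : ℕ} (X : Mat p) : Set (Mat p × Mat p) := {x | x ∈ M p ∧ F x = X}

/-- The scaling-rotation distance. -/
noncomputable def dSR {p : ℕ} (k : ℝ) (X Y : Mat p) : ℝ≥0∞ :=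
  ⨅ (x ∈ fiber X) (y ∈ fiber Y), dM k x y

/-- `γ` is an `F`-minimal geodesic from the fiber over `X` to the fiber over `Y`. -/
def IsFMinimalGeodesic {p : ℕ} (k : ℝ) (X Y : Mat p) (γ : ℝ → Mat p × Mat p) : Prop :=
  CurveIn (M p) γ ∧ γ 0 ∈ fiber X ∧ γ 1 ∈ fiber Y ∧ curveLength (metricM k) γ = dSR k X Y

/-- `(x, y)` is a minimal pair: `x` and `y` are the endpoints of an `F`-minimal geodesic
from the fiber containing `x` to the fiber containing `y`. -/
def IsMinimalPair {p : ℕ} (k : ℝ) (x y : Mat p × Mat p) : Prop :=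
  x ∈ M p ∧ y ∈ M p ∧
    ∃ γ : ℝ → Mat p × Mat p, IsFMinimalGeodesic k (F x) (F y) γ ∧ γ 0 = x ∧ γ 1 = y

/-! ### Sign changes -/

/-- The even sign-change matrices: diagonal matrices with diagonal entries `±1` and
determinant `1`. -/
def EvenSignChange (p : ℕ) : Set (Mat p) :=
  {S | S ∈ SO p ∧ S.IsDiag ∧ ∀ i, S i i = 1 ∨ S i i = -1}

/-- `(U,V)` is sign-change reducible. -/
def SignChangeReducible {p : ℕ} (U V : Mat p) : Prop :=
  ∃ S ∈ EvenSignChange p, dSO (U * S) V < dSO U V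

/-- The action of a permutation `π` on matrices (used for diagonal ones): the `(i,i)` entry of
`permAct π D` is the entry of `D` at `π⁻¹ i`. -/
def permAct {p : ℕ} (π : Equiv.Perm (Fin p)) (D : Mat p) : Mat p := D.submatrix π.symm π.symm

end ScalingRotation

/-!
Since the fibers of `F` over matrices with distinct eigenvalues are finite, a minimal pair arises
from a competition between rotating and rescaling. Take `D = Λ = spreadDiag p s`, with logarithmic
eigenvalues `0, s, 2 s, …`, and `s` larger than `√k * dSO U V`. The logarithm of each diagonal entry
varies along a curve in `M(p)` by at most its length (`log_sub_le_curveLength`), so a curve that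
ends at a different ordering of the eigenvalues than it starts with has length at least `s`. If
both end points carry the same ordering, their rotational parts are, up to a common right
translation, `U` and `V` with an even sign change (`dSO_le_of_fibers`), and since `(U, V)` is not
sign-change reducible the curve has length at least `√k * dSO U V`. Hence the distance of the two
fibers is `√k * dSO U V` (`sqrt_mul_dSO_le_dSR`), and it is attained by `t ↦ (c t, D)` as soon as
`c` is a shortest curve of `SO(p)` from `U` to `V`.

Such a curve exists (`exists_minimal_curve_SO`) by the following direct argument. The symmetric part
of `R = Uᵀ V` has an orthonormal eigenbasis `q j`, with eigenvalues `cos (θ j)`, `0 ≤ θ j ≤ π`. For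
a curve `c` in `SO(p)` from `U` to `V`, the vector `Uᵀ c(t) q j` moves on the unit sphere from `q j`
to `R q j`, which enclose the angle `θ j`; as twice the squared speed of `c` is the sum of the
squared speeds of these vectors, the Cauchy–Schwarz inequality gives the lower bound
`√(1/2 * ∑ j, θ j ^ 2)` for the length (`le_curveLength_SO`). Conversely, `R` is in the eigenbasis
a rotation by the angles `θ j` in orthogonal planes (`exists_frame`), and turning these planes at
constant speed gives a curve of exactly this length.
-/

namespace ScalingRotation

/-! ### Piecewise-smooth curves and calibrations -/

section Calculus

variable {E G : Type*} [NormedAddCommGroup E] [NormedSpace ℝ E]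
  [NormedAddCommGroup G] [NormedSpace ℝ G]

lemma PiecewiseSmooth.ae_differentiableAt {c : ℝ → E} (hc : PiecewiseSmooth c) :
    ∀ᵐ t ∂(volume.restrict (Icc (0 : ℝ) 1)), t ∈ Ioo (0 : ℝ) 1 ∧ DifferentiableAt ℝ c t := by
  obtain ⟨-, n, τ, hτ, h0, h1, hs⟩ := hc
  have hfin : ((τ '' (Finset.range (n + 1) : Set ℕ)) : Set ℝ).Countable :=
    ((Finset.finite_toSet _).image _).countable
  have hae : ∀ᵐ t : ℝ ∂(volume.restrict (Icc (0 : ℝ) 1)),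
      t ∉ τ '' (Finset.range (n + 1) : Set ℕ) :=
    ae_restrict_of_ae (hfin.ae_notMem _)
  filter_upwards [hae, ae_restrict_mem measurableSet_Icc] with t ht htI
  have hne : ∀ i ≤ n, τ i ≠ t := fun i hi h => ht ⟨i, by simpa [Nat.lt_succ_iff] using hi, h⟩
  have ht0 : 0 < t := lt_of_le_of_ne htI.1 (h0 ▸ hne 0 (Nat.zero_le _))
  have ht1 : t < 1 := lt_of_le_of_ne htI.2 (Ne.symm (h1 ▸ hne n le_rfl))
  refine ⟨⟨ht0, ht1⟩, ?_⟩
  have hex : ∃ i, t < τ i := ⟨n, h1 ▸ ht1⟩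
  classical
  obtain ⟨i, hi⟩ : ∃ i, Nat.find hex = i + 1 :=
    Nat.exists_eq_succ_of_ne_zero fun h => by
      have := Nat.find_spec hex
      rw [h, h0] at this
      linarith
  have hlt : t < τ (i + 1) := hi ▸ Nat.find_spec hex
  have hin : i < n := by
    have : Nat.find hex ≤ n := Nat.find_min' hex (h1 ▸ ht1)
    omega
  have hle : τ i ≤ t := not_lt.1 (Nat.find_min hex (by omega))
  have hlt' : τ i < t := lt_of_le_of_ne hle (hne i hin.le)
  exact ((hs i hin).contDiffAt (Icc_mem_nhds hlt' hlt)).differentiableAt (by simp)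

lemma PiecewiseSmooth.enorm_sub_le {f : ℝ → G} (hf : PiecewiseSmooth f) :
    ‖f 1 - f 0‖ₑ ≤ ∫⁻ t in Icc (0 : ℝ) 1, ‖deriv f t‖ₑ := by
  obtain ⟨-, n, τ, hτ, h0, h1, hs⟩ := hf
  have key : ∀ m ≤ n, ‖f (τ m) - f (τ 0)‖ₑ ≤ ∫⁻ t in Ioc (τ 0) (τ m), ‖deriv f t‖ₑ := by
    intro m
    induction m with
    | zero => intro _; simp
    | succ m ih =>
      intro hm
      have hpiece : ‖f (τ (m + 1)) - f (τ m)‖ₑ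
          ≤ ∫⁻ t in Ioc (τ m) (τ (m + 1)), ‖deriv f t‖ₑ := by
        rw [Measure.restrict_congr_set Ioc_ae_eq_Icc]
        exact enorm_sub_le_lintegral_deriv_of_contDiffOn_Icc
          ((hs m hm).of_le (by simp)) (hτ (Nat.le_succ m))
      rw [← Ioc_union_Ioc_eq_Ioc (hτ (Nat.zero_le m)) (hτ (Nat.le_succ m)),
        lintegral_union measurableSet_Ioc (Ioc_disjoint_Ioc_of_le le_rfl)]
      calc ‖f (τ (m + 1)) - f (τ 0)‖ₑ
          = ‖(f (τ m) - f (τ 0)) + (f (τ (m + 1)) - f (τ m))‖ₑ := by congr 1; abel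
        _ ≤ _ := (enorm_add_le _ _).trans (add_le_add (ih (by omega)) hpiece)
  have := key n le_rfl
  rwa [h0, h1, Measure.restrict_congr_set Ioc_ae_eq_Icc] at this

lemma CurveIn.comp {S : Set E} {c : ℝ → E} (hc : CurveIn S c) {φ : E → G}
    (hφ : ∀ x ∈ S, ContDiffAt ℝ ∞ φ x) : PiecewiseSmooth (φ ∘ c) := by
  obtain ⟨⟨hcont, n, τ, hτ, h0, h1, hs⟩, hS⟩ := hc
  refine ⟨fun t ht => ((hφ _ (hS t ht)).continuousAt.comp_continuousWithinAt (hcont t ht)),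
    n, τ, hτ, h0, h1, fun i hi t ht => ?_⟩
  have ht01 : t ∈ Icc (0 : ℝ) 1 :=
    ⟨h0 ▸ (hτ (Nat.zero_le i)).trans ht.1, h1 ▸ ht.2.trans (hτ hi)⟩
  exact (hφ _ (hS t ht01)).comp_contDiffWithinAt t (hs i hi t ht)

/-- A function whose derivative along curves is at most `C` times the speed varies by at most `C`
times the length. This is how every lower bound on a length is obtained. -/
lemma CurveIn.ofReal_sub_le_curveLength {S : Set E} {c : ℝ → E} (hc : CurveIn S c)
    {g : E → E → E → ℝ} {φ : E → ℝ} (hφ : ∀ x ∈ S, ContDiffAt ℝ ∞ φ x) {C : ℝ} (hC : 0 ≤ C)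
    (hb : ∀ t ∈ Ioo (0 : ℝ) 1, ∀ v, HasDerivAt c v t →
      |fderiv ℝ φ (c t) v| ≤ C * Real.sqrt (g (c t) v v)) :
    ENNReal.ofReal |φ (c 1) - φ (c 0)| ≤ ENNReal.ofReal C * curveLength g c := by
  have h1 := (hc.comp hφ).enorm_sub_le
  rw [← Real.enorm_eq_ofReal_abs, curveLength, ← lintegral_const_mul' _ _ ENNReal.ofReal_ne_top]
  refine h1.trans (lintegral_mono_ae ?_)
  filter_upwards [hc.1.ae_differentiableAt] with t ht
  have hd := ((hφ _ (hc.2 t (Ioo_subset_Icc_self ht.1))).differentiableAt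
    (by simp)).hasFDerivAt.comp_hasDerivAt t ht.2.hasDerivAt
  rw [hd.deriv, Real.enorm_eq_ofReal_abs, ← ENNReal.ofReal_mul hC]
  exact ENNReal.ofReal_le_ofReal (hb t ht.1 _ ht.2.hasDerivAt)

/-- Length is monotone under a map that does not increase speeds by more than a factor `C`. -/
lemma CurveIn.curveLength_comp_le {S : Set E} {c : ℝ → E} (hc : CurveIn S c)
    {g : E → E → E → ℝ} {h : G → G → G → ℝ} (φ : E →L[ℝ] G) {C : ℝ} (hC : 0 ≤ C)
    (hb : ∀ t ∈ Ioo (0 : ℝ) 1, ∀ v, HasDerivAt c v t →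
      C * Real.sqrt (h (φ (c t)) (φ v) (φ v)) ≤ Real.sqrt (g (c t) v v)) :
    ENNReal.ofReal C * curveLength h (φ ∘ c) ≤ curveLength g c := by
  rw [curveLength, curveLength, ← lintegral_const_mul' _ _ ENNReal.ofReal_ne_top]
  refine lintegral_mono_ae ?_
  filter_upwards [hc.1.ae_differentiableAt] with t ht
  rw [(φ.hasFDerivAt.comp_hasDerivAt t ht.2.hasDerivAt).deriv, ← ENNReal.ofReal_mul hC]
  exact ENNReal.ofReal_le_ofReal (hb t ht.1 _ ht.2.hasDerivAt)

lemma CurveIn.of_contDiff {S : Set E} {c : ℝ → E} (hc : ContDiff ℝ ∞ c) (hS : ∀ t, c t ∈ S) :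
    CurveIn S c :=
  ⟨⟨hc.continuous.continuousOn, 1, fun n => n, Nat.mono_cast, by simp, by simp,
    fun _ _ => hc.contDiffOn⟩, fun t _ => hS t⟩

lemma curveLength_of_constant_speed {g : E → E → E → ℝ} {c : ℝ → E} {a : ℝ}
    (h : ∀ t, g (c t) (deriv c t) (deriv c t) = a) :
    curveLength g c = ENNReal.ofReal (Real.sqrt a) := by
  simp [curveLength, h]

end Calculus

/-! ### The metrics of `SO(p)` and `Diag⁺(p)` in coordinates -/

/-- The entry `X i j` as a continuous linear functional of the matrix `X`. -/
noncomputable def entryCLM {p : ℕ} (i j : Fin p) : Mat p →L[ℝ] ℝ :=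
  (Matrix.entryLinearMap ℝ ℝ i j).toContinuousLinearMap

lemma hasDerivAt_entry {p : ℕ} {c : ℝ → Mat p} {v : Mat p} {t : ℝ} (h : HasDerivAt c v t)
    (i j : Fin p) : HasDerivAt (fun s => c s i j) (v i j) t :=
  (entryCLM i j).hasFDerivAt.comp_hasDerivAt t h

section SO

variable {p : ℕ}

lemma mem_SO {U : Mat p} : U ∈ SO p ↔ U * Uᵀ = 1 ∧ U.det = 1 := by
  rw [SO, Set.mem_ofPred_eq, Matrix.mem_specialOrthogonalGroup_iff,
    Matrix.mem_orthogonalGroup_iff]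

lemma SO_mul_transpose {U : Mat p} (h : U ∈ SO p) : U * Uᵀ = 1 := (mem_SO.1 h).1

lemma SO_transpose_mul {U : Mat p} (h : U ∈ SO p) : Uᵀ * U = 1 :=
  mul_eq_one_comm.1 (mem_SO.1 h).1

lemma SO_inv {U : Mat p} (h : U ∈ SO p) : U⁻¹ = Uᵀ :=
  Matrix.inv_eq_right_inv (SO_mul_transpose h)

lemma SO_mul {U V : Mat p} (hU : U ∈ SO p) (hV : V ∈ SO p) : U * V ∈ SO p :=
  (Matrix.specialOrthogonalGroup (Fin p) ℝ).mul_mem hU hV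

lemma SO_transpose {U : Mat p} (hU : U ∈ SO p) : Uᵀ ∈ SO p :=
  mem_SO.2 ⟨by rw [Matrix.transpose_transpose, SO_transpose_mul hU],
    by rw [Matrix.det_transpose, (mem_SO.1 hU).2]⟩

/-- The velocity of a curve in `SO(p)` is tangent to `SO(p)`. -/
lemma tangent_SO {c : ℝ → Mat p} (hc : ∀ t ∈ Icc (0 : ℝ) 1, c t ∈ SO p) {t : ℝ}
    (ht : t ∈ Ioo (0 : ℝ) 1) {v : Mat p} (hv : HasDerivAt c v t) :
    vᵀ * c t + (c t)ᵀ * v = 0 := by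
  ext i j
  have h1 : HasDerivAt (fun s => ∑ k, c s k i * c s k j)
      (∑ k, (v k i * c t k j + c t k i * v k j)) t :=
    HasDerivAt.fun_sum fun k _ => (hasDerivAt_entry hv k i).mul (hasDerivAt_entry hv k j)
  have h2 : (fun s => ∑ k, c s k i * c s k j) =ᶠ[nhds t] fun _ => (1 : Mat p) i j := by
    filter_upwards [Icc_mem_nhds ht.1 ht.2] with s hs
    rw [← SO_transpose_mul (hc s hs)]
    rfl
  have h3 := (h1.congr_of_eventuallyEq h2.symm).unique (hasDerivAt_const t _)
  rw [Finset.sum_add_distrib] at h3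
  exact h3

lemma metricSO_eq_sum {U A : Mat p} (hU : U ∈ SO p) (hA : Aᵀ * U + Uᵀ * A = 0) :
    metricSO U A A = (1 / 2) * ∑ i, ∑ j, A i j ^ 2 := by
  have h1 : Uᵀ * A = -(Aᵀ * U) := eq_neg_of_add_eq_zero_right hA
  have h2 : (Uᵀ * A) * (Uᵀ * A) = -(Aᵀ * A) := by
    nth_rewrite 1 [h1]
    rw [Matrix.neg_mul, Matrix.mul_assoc, ← Matrix.mul_assoc U, SO_mul_transpose hU,
      Matrix.one_mul]
  rw [metricSO, SO_inv hU, h2, Matrix.trace_neg, neg_mul_neg, Finset.sum_comm]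
  simp [Matrix.trace, Matrix.mul_apply, sq]

end SO

lemma metricDiag_eq_sum {p : ℕ} {D L : Mat p} (hD : D ∈ DiagPos p) (hL : L.IsDiag) :
    metricDiag D L L = ∑ i, (L i i / D i i) ^ 2 := by
  obtain ⟨d, rfl⟩ : ∃ d, D = Matrix.diagonal d := ⟨_, hD.1.diagonal_diag.symm⟩
  obtain ⟨l, rfl⟩ : ∃ l, L = Matrix.diagonal l := ⟨_, hL.diagonal_diag.symm⟩
  have hd : ∀ i, d i ≠ 0 := fun i => by simpa using (hD.2 i).ne'
  have hinv : (Matrix.diagonal d)⁻¹ = Matrix.diagonal fun i => (d i)⁻¹ := by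
    apply Matrix.inv_eq_right_inv
    rw [Matrix.diagonal_mul_diagonal, ← Matrix.diagonal_one]
    congr 1
    ext i
    exact mul_inv_cancel₀ (hd i)
  rw [metricDiag, hinv]
  simp only [Matrix.diagonal_mul_diagonal, Matrix.trace_diagonal, Matrix.diagonal_apply_eq]
  exact Finset.sum_congr rfl fun i _ => by ring

lemma isDiag_of_hasDerivAt {p : ℕ} {c : ℝ → Mat p} (hc : ∀ t ∈ Icc (0 : ℝ) 1, c t ∈ DiagPos p)
    {t : ℝ} (ht : t ∈ Ioo (0 : ℝ) 1) {v : Mat p} (hv : HasDerivAt c v t) : v.IsDiag := by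
  intro i j hij
  have h2 : (fun s => c s i j) =ᶠ[nhds t] fun _ => (0 : ℝ) := by
    filter_upwards [Icc_mem_nhds ht.1 ht.2] with s hs
    exact (hc s hs).1 hij
  exact ((hasDerivAt_entry hv i j).congr_of_eventuallyEq h2.symm).unique (hasDerivAt_const t _)

/-! ### Rotations in canonical form -/

section Adapted

variable {p : ℕ}

/-- `N` is a skew matrix preserving the level sets of the angles `θ`, and it is a complex structure
on the span of the coordinate vectors with nonzero angle, zero on the others. -/
structure IsAdapted (θ : Fin p → ℝ) (N : Mat p) : Prop where
  skew : Nᵀ = -N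
  block : ∀ i j, θ i ≠ θ j → N i j = 0
  sq : N * N = -Matrix.diagonal fun i => if θ i = 0 then 0 else 1

/-- The one-parameter group of rotations that turns the planes of `N` by the angles `t * θ i`. -/
noncomputable def rot (θ : Fin p → ℝ) (N : Mat p) (t : ℝ) : Mat p :=
  Matrix.diagonal (fun i => Real.cos (t * θ i)) + Matrix.diagonal (fun i => Real.sin (t * θ i)) * N

namespace IsAdapted

variable {θ : Fin p → ℝ} {N : Mat p}

lemma mul_diagonal (h : IsAdapted θ N) (f : ℝ → ℝ) :
    N * Matrix.diagonal (fun i => f (θ i)) = Matrix.diagonal (fun i => f (θ i)) * N := by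
  ext i j
  rw [Matrix.mul_diagonal, Matrix.diagonal_mul]
  by_cases hij : θ i = θ j
  · rw [hij, mul_comm]
  · rw [h.block i j hij, mul_zero, zero_mul]

/-- Matrices of the form `a + b N` with `a`, `b` functions of the angles multiply like complex
numbers, away from the vanishing angles. -/
lemma mul_formula (h : IsAdapted θ N) (a b : Fin p → ℝ) (f g : ℝ → ℝ) :
    (Matrix.diagonal a + Matrix.diagonal b * N) *
      (Matrix.diagonal (fun i => f (θ i)) + Matrix.diagonal (fun i => g (θ i)) * N) =
    Matrix.diagonal (fun i => a i * f (θ i) - if θ i = 0 then 0 else b i * g (θ i)) +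
      Matrix.diagonal (fun i => a i * g (θ i) + b i * f (θ i)) * N := by
  have h1 : Matrix.diagonal b * N * Matrix.diagonal (fun i => f (θ i)) =
      Matrix.diagonal (fun i => b i * f (θ i)) * N := by
    rw [Matrix.mul_assoc, h.mul_diagonal, ← Matrix.mul_assoc, Matrix.diagonal_mul_diagonal]
  have h2 : Matrix.diagonal b * N * (Matrix.diagonal (fun i => g (θ i)) * N) =
      -Matrix.diagonal (fun i => if θ i = 0 then 0 else b i * g (θ i)) := by
    rw [← Matrix.mul_assoc, Matrix.mul_assoc _ N, h.mul_diagonal, ← Matrix.mul_assoc,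
      Matrix.mul_assoc _ N N, h.sq, Matrix.diagonal_mul_diagonal, Matrix.mul_neg,
      Matrix.diagonal_mul_diagonal]
    congr 2
    ext i
    split_ifs <;> simp
  have h3 : Matrix.diagonal a * (Matrix.diagonal (fun i => g (θ i)) * N) =
      Matrix.diagonal (fun i => a i * g (θ i)) * N := by
    rw [← Matrix.mul_assoc, Matrix.diagonal_mul_diagonal]
  rw [Matrix.add_mul, Matrix.mul_add, Matrix.mul_add, h1, h2, h3, Matrix.diagonal_mul_diagonal,
    ← Matrix.diagonal_add, ← Matrix.diagonal_sub, Matrix.add_mul]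
  abel

lemma rot_mul (h : IsAdapted θ N) (s t : ℝ) : rot θ N s * rot θ N t = rot θ N (s + t) := by
  have := h.mul_formula (fun i => Real.cos (s * θ i)) (fun i => Real.sin (s * θ i))
    (fun x => Real.cos (t * x)) (fun x => Real.sin (t * x))
  rw [rot, rot, this, rot]
  congr 2
  · ext i
    rw [add_mul, Real.cos_add]
    split_ifs with h0 <;> simp [h0]
  · congr 1
    ext i
    rw [add_mul, Real.sin_add]
    ring

lemma rot_zero (θ : Fin p → ℝ) (N : Mat p) : rot θ N 0 = 1 := by
  simp [rot]

lemma rot_transpose (h : IsAdapted θ N) (t : ℝ) : (rot θ N t)ᵀ = rot θ N (-t) := by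
  have h1 : N * Matrix.diagonal (fun i => Real.sin (t * θ i)) =
      Matrix.diagonal (fun i => Real.sin (t * θ i)) * N := h.mul_diagonal fun x => Real.sin (t * x)
  have h2 : Matrix.diagonal (fun i => Real.sin (-t * θ i)) =
      -Matrix.diagonal (fun i => Real.sin (t * θ i)) := by
    rw [Matrix.diagonal_neg]
    congr 1
    ext i
    simp
  rw [rot, Matrix.transpose_add, Matrix.transpose_mul, Matrix.diagonal_transpose,
    Matrix.diagonal_transpose, h.skew, Matrix.neg_mul, h1, rot, h2, Matrix.neg_mul]
  simp

lemma rot_mem_SO (h : IsAdapted θ N) (t : ℝ) : rot θ N t ∈ SO p := by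
  have ho : rot θ N t * (rot θ N t)ᵀ = 1 := by
    rw [h.rot_transpose, h.rot_mul, add_neg_cancel, rot_zero]
  refine mem_SO.2 ⟨ho, ?_⟩
  have h1 : (rot θ N t).det * (rot θ N t).det = 1 := by
    simpa using congrArg Matrix.det ho
  -- The determinant is a square, hence the sign is `+`.
  have h2 : (rot θ N t).det = (rot θ N (t / 2)).det * (rot θ N (t / 2)).det := by
    rw [← Matrix.det_mul, h.rot_mul, add_halves]
  nlinarith [mul_self_nonneg (rot θ N (t / 2)).det]

end IsAdapted

/-- The trace that determines the constant speed of `rot θ N`, whose infinitesimal generator is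
`Matrix.diagonal θ * N`. -/
lemma IsAdapted.trace_generator_sq {θ : Fin p → ℝ} {N : Mat p} (h : IsAdapted θ N) :
    ((Matrix.diagonal θ * N) * (Matrix.diagonal θ * N)).trace = -∑ i, θ i ^ 2 := by
  have := h.mul_formula 0 θ (fun _ => 0) id
  simp only [id, Pi.zero_apply, Matrix.diagonal_zero, zero_add, mul_zero, zero_mul, zero_sub,
    add_zero] at this
  have hz : (Matrix.diagonal (0 : Fin p → ℝ) : Mat p) = 0 := Matrix.diagonal_zero
  rw [hz, zero_add] at this
  rw [this, Matrix.trace_diagonal, ← Finset.sum_neg_distrib]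
  refine Finset.sum_congr rfl fun i _ => ?_
  split_ifs with h0
  · simp [h0]
  · ring

lemma diagonal_eq_sum (a : Fin p → ℝ) :
    (Matrix.diagonal a : Mat p) = ∑ i, a i • Matrix.single i i (1 : ℝ) := by
  ext i j
  simp [Matrix.sum_apply, Matrix.diagonal_apply, Matrix.single_apply, ite_and]

lemma rot_eq_sum (θ : Fin p → ℝ) (N : Mat p) (t : ℝ) :
    rot θ N t = ∑ i, (Real.cos (t * θ i) • Matrix.single i i (1 : ℝ) +
      Real.sin (t * θ i) • (Matrix.single i i (1 : ℝ) * N)) := by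
  simp only [rot, diagonal_eq_sum, Finset.sum_add_distrib, Finset.sum_mul, Matrix.smul_mul]

lemma rot_contDiff (θ : Fin p → ℝ) (N : Mat p) : ContDiff ℝ ∞ (rot θ N) := by
  rw [show rot θ N = _ from funext (rot_eq_sum θ N)]
  refine ContDiff.sum fun i _ => ContDiff.add ?_ ?_
  · exact (Real.contDiff_cos.comp (contDiff_id.mul contDiff_const)).smul contDiff_const
  · exact (Real.contDiff_sin.comp (contDiff_id.mul contDiff_const)).smul contDiff_const

lemma IsAdapted.hasDerivAt_rot {θ : Fin p → ℝ} {N : Mat p} (h : IsAdapted θ N) (t : ℝ) :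
    HasDerivAt (rot θ N) (rot θ N t * (Matrix.diagonal θ * N)) t := by
  have h1 : HasDerivAt (rot θ N) (∑ i, ((-Real.sin (t * θ i) * θ i) • Matrix.single i i (1 : ℝ) +
      (Real.cos (t * θ i) * θ i) • (Matrix.single i i (1 : ℝ) * N))) t := by
    rw [show rot θ N = _ from funext (rot_eq_sum θ N)]
    refine HasDerivAt.fun_sum fun i _ => ?_
    have hl : HasDerivAt (fun t : ℝ => t * θ i) (θ i) t := hasDerivAt_mul_const _
    exact (hl.cos.smul_const _).add (hl.sin.smul_const _)
  convert h1 using 1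
  have h2 := h.mul_formula (fun i => Real.cos (t * θ i)) (fun i => Real.sin (t * θ i))
    (fun _ => 0) id
  have h0 : (Matrix.diagonal (fun _ => 0) : Mat p) = 0 := Matrix.diagonal_zero
  have hg : (Matrix.diagonal (fun i => id (θ i)) : Mat p) = Matrix.diagonal θ := rfl
  rw [h0, zero_add, hg] at h2
  rw [rot, h2, diagonal_eq_sum, diagonal_eq_sum, Finset.sum_add_distrib, Finset.sum_mul]
  congr 1
  · refine Finset.sum_congr rfl fun i _ => ?_
    congr 1
    split_ifs with h0 <;> simp [h0]
  · simp only [Matrix.smul_mul, mul_zero, add_zero, id]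

end Adapted

section CanonicalForm

variable {p : ℕ}

/-- A set of coordinates of even cardinality carries a complex structure. -/
lemma exists_complex_structure (m : ℕ) : ∀ s : Finset (Fin p), s.card = 2 * m →
    ∃ J : Mat p, Jᵀ = -J ∧ (∀ i j, i ∉ s → J i j = 0) ∧
      J * J = -Matrix.diagonal fun i => if i ∈ s then 1 else 0 := by
  induction m with
  | zero =>
    intro s hs
    have : s = ∅ := by simpa using hs
    exact ⟨0, by simp, by simp, by simp [this]⟩
  | succ m ih =>
    intro s hs
    obtain ⟨a, s', ha, rfl, hs'⟩ := Finset.card_eq_succ.1 (show s.card = (2 * m + 1) + 1 by omega)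
    obtain ⟨b, s, hb, rfl, hs''⟩ := Finset.card_eq_succ.1 hs'
    obtain ⟨J, hskew, hsupp, hsq⟩ := ih s hs''
    simp only [Finset.mem_insert, not_or] at ha
    have hsupp' : ∀ i j, j ∉ s → J i j = 0 := fun i j hj => by
      have : J i j = -J j i := congrFun (congrFun hskew j) i
      rw [this, hsupp j i hj, neg_zero]
    have hl : ∀ i j : Fin p, i ∉ s → J * Matrix.single i j (1 : ℝ) = 0 := fun i j hi => by
      ext x y
      by_cases hy : y = j
      · subst hy
        simp [hsupp' x i hi]
      · simp [hy]
    have hr : ∀ i j : Fin p, j ∉ s → Matrix.single i j (1 : ℝ) * J = 0 := fun i j hj => by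
      ext x y
      by_cases hx : x = i
      · subst hx
        simp [hsupp j y hj]
      · simp [hx]
    refine ⟨J + (Matrix.single a b 1 - Matrix.single b a 1), ?_, ?_, ?_⟩
    · rw [Matrix.transpose_add, Matrix.transpose_sub, hskew, Matrix.transpose_single,
        Matrix.transpose_single]
      abel
    · intro i j hi
      simp only [Finset.mem_insert, not_or] at hi
      simp [hsupp i j hi.2.2, Ne.symm hi.1, Ne.symm hi.2.1]
    · rw [add_mul, mul_add, mul_add, hsq, mul_sub, sub_mul, mul_sub, sub_mul, sub_mul, hl _ _ ha.2,
        hl _ _ hb, hr _ _ ha.2, hr _ _ hb, Matrix.single_mul_single_same,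
        Matrix.single_mul_single_same, Matrix.single_mul_single_of_ne _ _ _ _ ha.1,
        Matrix.single_mul_single_of_ne _ _ _ _ (Ne.symm ha.1)]
      ext i j
      by_cases hij : i = j
      · subst hij
        by_cases hia : i = a
        · subst hia
          simp [ha.1, ha.2, Ne.symm ha.1]
        · by_cases hib : i = b
          · subst hib
            simp [hb, Ne.symm hia]
          · simp [hia, hib, Ne.symm hia, Ne.symm hib]
      · simp only [Matrix.sub_apply, Matrix.add_apply, Matrix.neg_apply, Matrix.zero_apply,
          Matrix.diagonal_apply_ne _ hij, Matrix.single_apply]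
        grind

/-- A rotation `R` whose symmetric part is the diagonal matrix `l` is the time-one value of a
one-parameter group `rot θ N`, with angles `θ i = arccos (l i)` in `[0, π]`. The skew part `K` of
`R` commutes with the symmetric part and satisfies `K * K = l ^ 2 - 1`, so `N` is `K` divided by
`sin (θ i)` where `l i ≠ ± 1`, and `0` where `l i = 1`. Where `l i = -1`, a complex structure exists
since `det R = 1` makes the multiplicity even. -/
lemma exists_rot_eq {R : Mat p} (hR : R ∈ SO p) {l : Fin p → ℝ}
    (hl : R + Rᵀ = Matrix.diagonal fun i => 2 * l i) :
    ∃ (θ : Fin p → ℝ) (N : Mat p), IsAdapted θ N ∧ (∀ i, 0 ≤ θ i ∧ θ i ≤ Real.pi) ∧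
      R = rot θ N 1 ∧ ∀ i, R i i = Real.cos (θ i) := by
  obtain ⟨K, rfl⟩ : ∃ K, R = Matrix.diagonal l + K := ⟨R - Matrix.diagonal l, by abel⟩
  set Λ : Mat p := Matrix.diagonal l with hΛ
  have hΛt : Λᵀ = Λ := Matrix.diagonal_transpose _
  have hskew : Kᵀ = -K := by
    have h2 : (Matrix.diagonal fun i => 2 * l i : Mat p) = Λ + Λ := by
      rw [hΛ, Matrix.diagonal_add]
      congr 1
      ext i
      ring
    rw [h2, Matrix.transpose_add, hΛt] at hl
    have : K + Kᵀ = 0 := by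
      have h3 : Λ + K + (Λ + Kᵀ) = (Λ + Λ) + (K + Kᵀ) := by abel
      rw [h3] at hl
      simpa using hl
    exact eq_neg_of_add_eq_zero_right this
  have h1 := SO_mul_transpose hR
  have h2 := SO_transpose_mul hR
  rw [Matrix.transpose_add, hΛt, hskew] at h1 h2
  have hcomm : Λ * K = K * Λ := by
    have h3 : (Λ + K) * (Λ + -K) - (Λ + -K) * (Λ + K) = (2 : ℝ) • (K * Λ - Λ * K) := by
      rw [two_smul]
      noncomm_ring
    rw [h1, h2, sub_self] at h3
    have := (smul_eq_zero.1 h3.symm).resolve_left two_ne_zero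
    exact (sub_eq_zero.1 this).symm
  have hKK : K * K = Λ * Λ - 1 := by
    have h3 : (Λ + K) * (Λ + -K) = Λ * Λ - K * K - (Λ * K - K * Λ) := by noncomm_ring
    rw [h1, hcomm, sub_self, sub_zero] at h3
    rw [h3]
    abel
  have hblock : ∀ i j, l i ≠ l j → K i j = 0 := by
    intro i j hij
    have := congrFun (congrFun hcomm i) j
    rw [hΛ, Matrix.diagonal_mul, Matrix.mul_diagonal] at this
    have h3 : (l i - l j) * K i j = 0 := by linarith
    exact (mul_eq_zero.1 h3).resolve_left (sub_ne_zero.2 hij)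
  have hsum : ∀ i, ∑ j, K i j ^ 2 = 1 - l i ^ 2 := by
    intro i
    have h3 := congrFun (congrFun hKK i) i
    rw [hΛ, Matrix.diagonal_mul_diagonal, Matrix.sub_apply, Matrix.diagonal_apply_eq,
      Matrix.one_apply_eq, Matrix.mul_apply] at h3
    have h4 : ∀ j, K i j * K j i = -K i j ^ 2 := fun j => by
      have : K j i = -K i j := congrFun (congrFun hskew i) j
      rw [this]
      ring
    simp only [h4, Finset.sum_neg_distrib] at h3
    linarith
  have hle : ∀ i, l i ^ 2 ≤ 1 := fun i => by
    have : 0 ≤ ∑ j, K i j ^ 2 := Finset.sum_nonneg fun j _ => sq_nonneg _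
    linarith [hsum i]
  have hzero : ∀ i, l i ^ 2 = 1 → ∀ j, K i j = 0 := fun i hi j => by
    have h3 : ∑ j, K i j ^ 2 = 0 := by rw [hsum i, hi, sub_self]
    have := (Finset.sum_eq_zero_iff_of_nonneg fun j _ => sq_nonneg (K i j)).1 h3 j
      (Finset.mem_univ j)
    simpa using this
  have hl1 : ∀ i, -1 ≤ l i := fun i => (abs_le_one_iff_mul_self_le_one.2
    (by simpa [sq] using hle i) |> abs_le.1).1
  have hl2 : ∀ i, l i ≤ 1 := fun i => (abs_le_one_iff_mul_self_le_one.2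
    (by simpa [sq] using hle i) |> abs_le.1).2
  set θ : Fin p → ℝ := fun i => Real.arccos (l i) with hθ
  have hcos : ∀ i, Real.cos (θ i) = l i := fun i => Real.cos_arccos (hl1 i) (hl2 i)
  set σ : Fin p → ℝ := fun i => Real.sqrt (1 - l i ^ 2) with hσ
  have hsin : ∀ i, Real.sin (θ i) = σ i := fun i => Real.sin_arccos _
  have hσ0 : ∀ i, σ i = 0 ↔ l i ^ 2 = 1 := fun i => by
    rw [hσ]
    simp only
    rw [Real.sqrt_eq_zero (by linarith [hle i])]
    constructor <;> intro h <;> linarith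
  have hσsq : ∀ i, σ i ^ 2 = 1 - l i ^ 2 := fun i => Real.sq_sqrt (by linarith [hle i])
  -- On the eigenspaces of the symmetric part with eigenvalue `≠ ± 1`, the normalized
  -- skew part is a complex structure.
  set N₀ : Mat p := Matrix.diagonal (fun i => (σ i)⁻¹) * K with hN₀
  have hN₀a : ∀ i j, N₀ i j = (σ i)⁻¹ * K i j := fun i j => Matrix.diagonal_mul _ _ _ _
  have hN₀z : ∀ i, l i ^ 2 = 1 → ∀ j, N₀ i j = 0 := fun i hi j => by
    rw [hN₀a, hzero i hi, mul_zero]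
  have hN₀b : ∀ i j, l i ≠ l j → N₀ i j = 0 := fun i j hij => by
    rw [hN₀a, hblock i j hij, mul_zero]
  have hN₀skew : N₀ᵀ = -N₀ := by
    ext i j
    rw [Matrix.transpose_apply, Matrix.neg_apply, hN₀a, hN₀a]
    have h3 : K j i = -K i j := congrFun (congrFun hskew i) j
    by_cases hij : l i = l j
    · have : σ i = σ j := by simp only [hσ, hij]
      rw [h3, this]
      ring
    · rw [h3, hblock i j hij]
      simp
  have hKN : Matrix.diagonal σ * N₀ = K := by
    ext i j
    rw [Matrix.diagonal_mul, hN₀a]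
    by_cases hi : l i ^ 2 = 1
    · rw [hzero i hi]
      simp
    · rw [mul_inv_cancel_left₀ (mt (hσ0 i).1 hi)]
  have hN₀sq : N₀ * N₀ = -Matrix.diagonal fun i => if l i ^ 2 = 1 then 0 else 1 := by
    have h3 : K * Matrix.diagonal (fun i => (σ i)⁻¹) = Matrix.diagonal (fun i => (σ i)⁻¹) * K := by
      ext i j
      rw [Matrix.mul_diagonal, Matrix.diagonal_mul]
      by_cases hij : l i = l j
      · have : σ i = σ j := by simp only [hσ, hij]
        rw [this, mul_comm]
      · rw [hblock i j hij, mul_zero, zero_mul]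
    have h4 : (1 : Mat p) = Matrix.diagonal fun _ => 1 := Matrix.diagonal_one.symm
    rw [hN₀, ← Matrix.mul_assoc, Matrix.mul_assoc _ K, h3, ← Matrix.mul_assoc, Matrix.mul_assoc _ K,
      hKK, hΛ, h4, Matrix.diagonal_mul_diagonal, Matrix.diagonal_mul_diagonal, Matrix.diagonal_sub,
      Matrix.diagonal_mul_diagonal, Matrix.diagonal_neg]
    congr 1
    ext i
    split_ifs with hi
    · rw [(hσ0 i).2 hi]
      simp
    · have h5 := hσsq i
      have h6 : σ i ≠ 0 := mt (hσ0 i).1 hi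
      have h7 : l i * l i - 1 = -(σ i ^ 2) := by rw [h5]; ring
      rw [h7]
      field_simp
  classical
  have hsq1 : ∀ i, l i ≠ -1 → (l i ^ 2 = 1 ↔ l i = 1) := fun i hi => by
    refine ⟨fun h => ?_, fun h => by rw [h, one_pow]⟩
    have h3 : (l i - 1) * (l i + 1) = 0 := by linear_combination h
    rcases mul_eq_zero.1 h3 with h4 | h4
    · linarith
    · exact absurd (by linarith) hi
  set s : Finset (Fin p) := Finset.univ.filter fun i => l i = -1 with hs
  have hmem : ∀ i, i ∈ s ↔ l i = -1 := fun i => by simp [hs]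
  -- The eigenvalue `-1` has even multiplicity, by comparing determinants.
  have heven : Even s.card := by
    set θ' : Fin p → ℝ := fun i => if l i = -1 then 0 else θ i with hθ'
    have hθ'0 : ∀ i, θ' i = 0 ↔ l i ^ 2 = 1 := fun i => by
      simp only [hθ']
      split_ifs with hi
      · simp [hi]
      · rw [hθ]
        simp only
        rw [Real.arccos_eq_zero, hsq1 i hi]
        exact ⟨fun h => le_antisymm (hl2 i) h, fun h => h.ge⟩
    have had : IsAdapted θ' N₀ := by
      refine ⟨hN₀skew, fun i j hij => hN₀b i j fun h => hij ?_, ?_⟩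
      · simp only [hθ', hθ, h]
      · rw [hN₀sq]
        simp only [hθ'0]
    have hfac : Λ + K = rot θ' N₀ 1 * Matrix.diagonal fun i => if i ∈ s then -1 else 1 := by
      rw [rot, Matrix.add_mul, Matrix.diagonal_mul_diagonal]
      congr 1
      · rw [hΛ]
        congr 1
        ext i
        simp only [hmem, hθ', one_mul]
        split_ifs with hi
        · simp [hi]
        · rw [hcos, mul_one]
      · rw [← hKN]
        ext i j
        rw [Matrix.mul_diagonal, Matrix.diagonal_mul, Matrix.diagonal_mul]
        simp only [hmem, hθ', one_mul]
        split_ifs with hi hj hj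
        · rw [hN₀z i (by rw [hi]; norm_num)]; simp
        · rw [hN₀z i (by rw [hi]; norm_num)]; simp
        · rw [hN₀b i j (by rw [hj]; exact hi)]; simp
        · rw [hsin, mul_one]
    have hdet := congrArg Matrix.det hfac
    rw [(mem_SO.1 hR).2, Matrix.det_mul, (mem_SO.1 (had.rot_mem_SO 1)).2, one_mul,
      Matrix.det_diagonal, Finset.prod_ite_mem, Finset.univ_inter, Finset.prod_const] at hdet
    exact neg_one_pow_eq_one_iff_even (by norm_num) |>.1 hdet.symm
  obtain ⟨m, hm⟩ := heven
  obtain ⟨J, hJskew, hJsupp, hJsq⟩ := exists_complex_structure m s (by omega)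
  have hJsupp' : ∀ i j, j ∉ s → J i j = 0 := fun i j hj => by
    have : J i j = -J j i := congrFun (congrFun hJskew j) i
    rw [this, hJsupp j i hj, neg_zero]
  have hsz : ∀ i ∈ s, l i ^ 2 = 1 := fun i hi => by rw [(hmem i).1 hi]; norm_num
  have hN₀J : N₀ * J = 0 := by
    ext i j
    rw [Matrix.mul_apply]
    refine Finset.sum_eq_zero fun x _ => ?_
    by_cases hx : x ∈ s
    · have : N₀ i x = -N₀ x i := congrFun (congrFun hN₀skew x) i
      rw [this, hN₀z x (hsz x hx), neg_zero, zero_mul]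
    · rw [hJsupp x j hx, mul_zero]
  have hJN₀ : J * N₀ = 0 := by
    ext i j
    rw [Matrix.mul_apply]
    refine Finset.sum_eq_zero fun x _ => ?_
    by_cases hx : x ∈ s
    · rw [hN₀z x (hsz x hx), mul_zero]
    · rw [hJsupp' i x hx, zero_mul]
  have had : IsAdapted θ (N₀ + J) := by
    refine ⟨?_, fun i j hij => ?_, ?_⟩
    · rw [Matrix.transpose_add, hN₀skew, hJskew]
      abel
    · have hij' : l i ≠ l j := fun h => hij (by simp only [hθ, h])
      rw [Matrix.add_apply, hN₀b i j hij', zero_add]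
      by_cases hi : i ∈ s
      · exact hJsupp' i j fun hj => hij' (((hmem i).1 hi).trans ((hmem j).1 hj).symm)
      · exact hJsupp i j hi
    · rw [Matrix.add_mul, Matrix.mul_add, Matrix.mul_add, hN₀J, hJN₀, hN₀sq, hJsq, add_zero,
        zero_add, ← neg_add, Matrix.diagonal_add]
      congr 2
      ext i
      simp only [hθ, hmem, Real.arccos_eq_zero]
      by_cases hi : l i = -1
      · simp [hi]
      · by_cases hi1 : l i = 1
        · simp [hi1]
          norm_num
        · have hi2 : l i ^ 2 ≠ 1 := mt (hsq1 i hi).1 hi1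
          simp [hi2, hi, lt_of_le_of_ne (hl2 i) hi1]
  refine ⟨θ, N₀ + J, had, fun i => ⟨Real.arccos_nonneg _, Real.arccos_le_pi _⟩, ?_, fun i => ?_⟩
  · rw [rot, Matrix.mul_add]
    simp only [one_mul, hcos, hsin]
    rw [hKN]
    have : Matrix.diagonal σ * J = 0 := by
      ext i j
      rw [Matrix.diagonal_mul]
      by_cases hi : i ∈ s
      · rw [(hσ0 i).2 (hsz i hi)]
        simp
      · rw [hJsupp i j hi, mul_zero]
        rfl
    rw [this, add_zero]
  · have : K i i = -K i i := congrFun (congrFun hskew i) i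
    rw [hcos, Matrix.add_apply, hΛ, Matrix.diagonal_apply_eq, self_eq_neg.1 this, add_zero]

/-- Every rotation becomes, in a suitable orthonormal basis, the time-one value of a one-parameter
group `rot θ N`. -/
lemma exists_frame {R : Mat p} (hR : R ∈ SO p) :
    ∃ (Q : Mat p) (θ : Fin p → ℝ) (N : Mat p), Q * Qᵀ = 1 ∧ IsAdapted θ N ∧
      (∀ i, 0 ≤ θ i ∧ θ i ≤ Real.pi) ∧ Qᵀ * R * Q = rot θ N 1 ∧
      ∀ i, (Qᵀ * R * Q) i i = Real.cos (θ i) := by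
  have hS : (R + Rᵀ).IsHermitian := by
    rw [Matrix.IsHermitian, Matrix.conjTranspose_eq_transpose_of_trivial, Matrix.transpose_add,
      Matrix.transpose_transpose, add_comm]
  set Q : Mat p := (hS.eigenvectorUnitary : Mat p) with hQ
  have hQQ : Q * Qᵀ = 1 := by
    have := (Matrix.mem_unitaryGroup_iff).1 hS.eigenvectorUnitary.2
    rwa [Matrix.star_eq_conjTranspose, Matrix.conjTranspose_eq_transpose_of_trivial] at this
  have hQQ' : Qᵀ * Q = 1 := mul_eq_one_comm.1 hQQ
  have hdiag : Qᵀ * (R + Rᵀ) * Q = Matrix.diagonal hS.eigenvalues := by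
    have h1 := hS.spectral_theorem
    rw [Unitary.conjStarAlgAut_apply] at h1
    have h2 : R + Rᵀ = Q * Matrix.diagonal hS.eigenvalues * Qᵀ := h1
    calc Qᵀ * (R + Rᵀ) * Q = Qᵀ * (Q * Matrix.diagonal hS.eigenvalues * Qᵀ) * Q :=
          congrArg (fun X => Qᵀ * X * Q) h2
      _ = (Qᵀ * Q) * Matrix.diagonal hS.eigenvalues * (Qᵀ * Q) := by noncomm_ring
      _ = _ := by rw [hQQ', Matrix.one_mul, Matrix.mul_one]
  have hdet : Q.det * Q.det = 1 := by simpa using congrArg Matrix.det hQQ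
  have hR' : Qᵀ * R * Q ∈ SO p := by
    refine mem_SO.2 ⟨?_, ?_⟩
    · rw [Matrix.transpose_mul, Matrix.transpose_mul, Matrix.transpose_transpose]
      calc Qᵀ * R * Q * (Qᵀ * (Rᵀ * Q)) = Qᵀ * R * (Q * Qᵀ) * (Rᵀ * Q) := by noncomm_ring
        _ = Qᵀ * (R * Rᵀ) * Q := by rw [hQQ]; noncomm_ring
        _ = 1 := by rw [SO_mul_transpose hR, Matrix.mul_one, hQQ']
    · rw [Matrix.det_mul, Matrix.det_mul, Matrix.det_transpose, (mem_SO.1 hR).2, mul_one, hdet]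
  obtain ⟨θ, N, had, hθ, h1, h2⟩ := exists_rot_eq hR' (l := fun i => hS.eigenvalues i / 2) (by
    rw [Matrix.transpose_mul, Matrix.transpose_mul, Matrix.transpose_transpose, ← Matrix.mul_assoc,
      ← Matrix.add_mul, ← Matrix.mul_add, hdiag]
    congr 1
    ext i
    ring)
  exact ⟨Q, θ, N, hQQ, had, hθ, h1, h2⟩

end CanonicalForm

/-! ### The distance of `SO(p)` is attained -/

section SODistance

variable {p : ℕ}

/-- A tangent vector `w` at the point `u` of the unit sphere: its component in a coordinate
direction is bounded by the distance of `u` to that axis. -/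
lemma sq_le_of_tangent_sphere (u w : Fin p → ℝ) (hu : ∑ i, u i ^ 2 = 1)
    (huw : ∑ i, u i * w i = 0) (j : Fin p) : w j ^ 2 ≤ (1 - u j ^ 2) * ∑ i, w i ^ 2 := by
  classical
  have h1 : w j = ∑ i, ((if i = j then 1 else 0) - u j * u i) * w i := by
    simp only [sub_mul, Finset.sum_sub_distrib, mul_assoc, ← Finset.mul_sum, huw]
    simp
  have h2 : ∑ i, ((if i = j then 1 else 0) - u j * u i) ^ 2 = 1 - u j ^ 2 := by
    have : ∀ i, ((if i = j then (1 : ℝ) else 0) - u j * u i) ^ 2 =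
        (if i = j then 1 - 2 * u j * u i else 0) + u j ^ 2 * u i ^ 2 := fun i => by
      split_ifs <;> ring
    simp only [this, Finset.sum_add_distrib, ← Finset.mul_sum, hu]
    simp
    ring
  calc w j ^ 2 = (∑ i, ((if i = j then 1 else 0) - u j * u i) * w i) ^ 2 := by rw [← h1]
    _ ≤ _ := Finset.sum_mul_sq_le_sq_mul_sq _ _ _
    _ = _ := by rw [h2]

lemma sum_sq_eq_trace (X : Mat p) : ∑ i, ∑ j, X i j ^ 2 = (Xᵀ * X).trace := by
  rw [Finset.sum_comm]
  simp [Matrix.trace, Matrix.mul_apply, sq]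

lemma sum_sq_conj {W Q : Mat p} (hW : Wᵀ * W = 1) (hQ : Q * Qᵀ = 1) (X : Mat p) :
    ∑ i, ∑ j, (W * X * Q) i j ^ 2 = ∑ i, ∑ j, X i j ^ 2 := by
  rw [sum_sq_eq_trace, sum_sq_eq_trace, Matrix.transpose_mul, Matrix.transpose_mul]
  calc (Qᵀ * (Xᵀ * Wᵀ) * (W * X * Q)).trace
      = ((Qᵀ * (Xᵀ * (Wᵀ * W) * X)) * Q).trace := by congr 1; noncomm_ring
    _ = _ := by rw [hW, Matrix.mul_one, Matrix.trace_mul_comm, ← Matrix.mul_assoc, hQ,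
      Matrix.one_mul]

/-- The functional `X ↦ (W X Q) j j`. -/
noncomputable def conjEntryCLM (W Q : Mat p) (j : Fin p) : Mat p →L[ℝ] ℝ :=
  (Matrix.entryLinearMap ℝ ℝ j j ∘ₗ LinearMap.mulRight ℝ Q ∘ₗ
    LinearMap.mulLeft ℝ W).toContinuousLinearMap

lemma conjEntryCLM_apply (W Q : Mat p) (j : Fin p) (X : Mat p) :
    conjEntryCLM W Q j X = (W * X * Q) j j := rfl

/-- The calibration `∑ j, θ j * arccos (r * (W X Q) j j)`. Each summand measures, for `r` close
to `1`, the spherical distance of the `j`-th column of `W X Q` to the `j`-th basis vector; the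
factor `r < 1` keeps it smooth. -/
noncomputable def angleCalibration (W Q : Mat p) (θ : Fin p → ℝ) (r : ℝ) (X : Mat p) : ℝ :=
  ∑ j, θ j * Real.arccos (r * conjEntryCLM W Q j X)

variable {W Q : Mat p}

lemma conj_col_sq (hW : Wᵀ * W = 1) (hQ : Q * Qᵀ = 1) {X : Mat p} (hX : X ∈ SO p)
    (j : Fin p) : ∑ i, (W * X * Q) i j ^ 2 = 1 := by
  have h : (W * X * Q)ᵀ * (W * X * Q) = 1 := by
    rw [Matrix.transpose_mul, Matrix.transpose_mul]
    calc Qᵀ * (Xᵀ * Wᵀ) * (W * X * Q) = Qᵀ * (Xᵀ * (Wᵀ * W) * X) * Q := by noncomm_ring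
      _ = 1 := by rw [hW, Matrix.mul_one, SO_transpose_mul hX, Matrix.mul_one,
        mul_eq_one_comm.1 hQ]
  have := congrFun (congrFun h j) j
  rw [Matrix.one_apply_eq, Matrix.mul_apply] at this
  simpa [sq] using this

lemma conjEntry_sq_le (hW : Wᵀ * W = 1) (hQ : Q * Qᵀ = 1) {X : Mat p}
    (hX : X ∈ SO p) (j : Fin p) : conjEntryCLM W Q j X ^ 2 ≤ 1 := by
  rw [← conj_col_sq hW hQ hX j, conjEntryCLM_apply]
  exact Finset.single_le_sum (f := fun i => (W * X * Q) i j ^ 2) (fun i _ => sq_nonneg _)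
    (Finset.mem_univ j)

lemma sq_mul_lt_one {r x : ℝ} (hr0 : 0 ≤ r) (hr1 : r < 1) (hx : x ^ 2 ≤ 1) : (r * x) ^ 2 < 1 := by
  rw [mul_pow]
  nlinarith [sq_nonneg x, sq_nonneg r]

lemma angleCalibration_fderiv (hW : Wᵀ * W = 1) (hQ : Q * Qᵀ = 1) (θ : Fin p → ℝ)
    {r : ℝ} (hr0 : 0 ≤ r) (hr1 : r < 1) {X : Mat p} (hX : X ∈ SO p) :
    ContDiffAt ℝ ∞ (angleCalibration W Q θ r) X ∧ ∀ v, fderiv ℝ (angleCalibration W Q θ r) X v =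
      ∑ j, θ j * (-(1 / Real.sqrt (1 - (r * conjEntryCLM W Q j X) ^ 2)) *
        (r * conjEntryCLM W Q j v)) := by
  have hne : ∀ j, r * conjEntryCLM W Q j X ≠ -1 ∧ r * conjEntryCLM W Q j X ≠ 1 := fun j => by
    have := sq_mul_lt_one hr0 hr1 (conjEntry_sq_le hW hQ hX j)
    constructor <;> intro h <;> rw [h] at this <;> norm_num at this
  constructor
  · refine ContDiffAt.sum fun j _ => contDiffAt_const.mul ?_
    exact ContDiffAt.comp (g := Real.arccos) (f := fun Y => r * conjEntryCLM W Q j Y) X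
      (Real.contDiffAt_arccos (hne j).1 (hne j).2)
      (contDiffAt_const.mul (conjEntryCLM W Q j).contDiff.contDiffAt)
  · intro v
    have h1 : HasFDerivAt (angleCalibration W Q θ r)
        (∑ j, θ j • ((-(1 / Real.sqrt (1 - (r * conjEntryCLM W Q j X) ^ 2))) •
          (r • conjEntryCLM W Q j))) X :=
      HasFDerivAt.fun_sum fun j _ => (HasDerivAt.comp_hasFDerivAt (h₂ := Real.arccos)
        (f := fun Y => r * conjEntryCLM W Q j Y) X (Real.hasDerivAt_arccos (hne j).1 (hne j).2)
        ((conjEntryCLM W Q j).hasFDerivAt.const_mul r)).const_mul (θ j)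
    rw [h1.fderiv]
    simp

/-- Along a curve in `SO(p)` each column of `W c Q` is a curve on the unit sphere, so its distance
to a fixed point grows at most with its speed. Cauchy–Schwarz combines the columns. -/
lemma angleCalibration_fderiv_le (hW : Wᵀ * W = 1) (hQ : Q * Qᵀ = 1) {θ : Fin p → ℝ}
    (hθ : ∀ i, 0 ≤ θ i) {r : ℝ} (hr0 : 0 ≤ r) (hr1 : r < 1) {X v : Mat p} (hX : X ∈ SO p)
    (hv : vᵀ * X + Xᵀ * v = 0) :
    |fderiv ℝ (angleCalibration W Q θ r) X v| ≤
      (Real.sqrt (∑ i, θ i ^ 2) * Real.sqrt 2) * Real.sqrt (metricSO X v v) := by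
  set w : Mat p := W * v * Q with hw
  have htan : ∀ j, ∑ i, (W * X * Q) i j * w i j = 0 := by
    intro j
    have h1 : (W * X * Q)ᵀ * w = Qᵀ * (Xᵀ * v) * Q := by
      rw [hw, Matrix.transpose_mul, Matrix.transpose_mul]
      calc Qᵀ * (Xᵀ * Wᵀ) * (W * v * Q) = Qᵀ * (Xᵀ * (Wᵀ * W) * v) * Q := by noncomm_ring
        _ = _ := by rw [hW, Matrix.mul_one]
    have h2 : ((W * X * Q)ᵀ * w)ᵀ = -((W * X * Q)ᵀ * w) := by
      rw [h1, Matrix.transpose_mul, Matrix.transpose_mul, Matrix.transpose_mul,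
        Matrix.transpose_transpose, Matrix.transpose_transpose, eq_neg_of_add_eq_zero_left hv]
      noncomm_ring
    have h3 : ((W * X * Q)ᵀ * w) j j = -((W * X * Q)ᵀ * w) j j := congrFun (congrFun h2 j) j
    have h4 := self_eq_neg.1 h3
    rwa [Matrix.mul_apply] at h4
  have hterm : ∀ j, |-(1 / Real.sqrt (1 - (r * conjEntryCLM W Q j X) ^ 2)) *
      (r * conjEntryCLM W Q j v)| ≤ Real.sqrt (∑ i, w i j ^ 2) := by
    intro j
    set x := conjEntryCLM W Q j X with hx
    have hx1 : x ^ 2 ≤ 1 := conjEntry_sq_le hW hQ hX j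
    have hpos : 0 < 1 - (r * x) ^ 2 := by linarith [sq_mul_lt_one hr0 hr1 hx1]
    have h1 : w j j ^ 2 ≤ (1 - x ^ 2) * ∑ i, w i j ^ 2 :=
      sq_le_of_tangent_sphere (fun i => (W * X * Q) i j) (fun i => w i j)
        (conj_col_sq hW hQ hX j) (htan j) j
    have hn : 0 ≤ ∑ i, w i j ^ 2 := Finset.sum_nonneg fun i _ => sq_nonneg _
    apply Real.abs_le_sqrt
    rw [conjEntryCLM_apply, ← hw, mul_pow, neg_sq, div_pow, Real.sq_sqrt hpos.le, one_pow,
      one_div, inv_mul_le_iff₀ hpos]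
    have h2 : r ^ 2 * (1 - x ^ 2) ≤ 1 - (r * x) ^ 2 := by nlinarith
    calc (r * w j j) ^ 2 = r ^ 2 * w j j ^ 2 := by ring
      _ ≤ r ^ 2 * ((1 - x ^ 2) * ∑ i, w i j ^ 2) := by gcongr
      _ = (r ^ 2 * (1 - x ^ 2)) * ∑ i, w i j ^ 2 := by ring
      _ ≤ _ := by gcongr
  have hmet : ∑ j, ∑ i, w i j ^ 2 = 2 * metricSO X v v := by
    rw [Finset.sum_comm, hw, sum_sq_conj hW hQ, metricSO_eq_sum hX hv]
    ring
  rw [(angleCalibration_fderiv hW hQ θ hr0 hr1 hX).2]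
  calc |∑ j, θ j * (-(1 / Real.sqrt (1 - (r * conjEntryCLM W Q j X) ^ 2)) *
        (r * conjEntryCLM W Q j v))|
      ≤ ∑ j, θ j * Real.sqrt (∑ i, w i j ^ 2) := by
        refine (Finset.abs_sum_le_sum_abs _ _).trans (Finset.sum_le_sum fun j _ => ?_)
        rw [abs_mul, abs_of_nonneg (hθ j)]
        exact mul_le_mul_of_nonneg_left (hterm j) (hθ j)
    _ ≤ Real.sqrt (∑ i, θ i ^ 2) * Real.sqrt (∑ j, Real.sqrt (∑ i, w i j ^ 2) ^ 2) :=
        Real.sum_mul_le_sqrt_mul_sqrt _ _ _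
    _ = _ := by
        have : ∀ j, Real.sqrt (∑ i, w i j ^ 2) ^ 2 = ∑ i, w i j ^ 2 := fun j =>
          Real.sq_sqrt (Finset.sum_nonneg fun i _ => sq_nonneg _)
        simp only [this, hmet]
        rw [Real.sqrt_mul zero_le_two, mul_assoc]

/-- Curves in `SO(p)` are at least as long as the combined rotation angles of their end points. -/
lemma le_curveLength_SO (hQ : Q * Qᵀ = 1) {U V : Mat p} (hU : U ∈ SO p) {θ : Fin p → ℝ}
    (hθ : ∀ i, 0 ≤ θ i ∧ θ i ≤ Real.pi)
    (hV : ∀ i, (Qᵀ * (Uᵀ * V) * Q) i i = Real.cos (θ i)) {c : ℝ → Mat p} (hc : CurveIn (SO p) c)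
    (h0 : c 0 = U) (h1 : c 1 = V) :
    ENNReal.ofReal (Real.sqrt ((1 / 2) * ∑ i, θ i ^ 2)) ≤ curveLength metricSO c := by
  set W : Mat p := Qᵀ * Uᵀ with hWdef
  have hW : Wᵀ * W = 1 := by
    rw [hWdef, Matrix.transpose_mul, Matrix.transpose_transpose, Matrix.transpose_transpose]
    calc U * Q * (Qᵀ * Uᵀ) = U * (Q * Qᵀ) * Uᵀ := by noncomm_ring
      _ = 1 := by rw [hQ, Matrix.mul_one, SO_mul_transpose hU]
  have hψ0 : ∀ j, conjEntryCLM W Q j U = 1 := fun j => by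
    rw [conjEntryCLM_apply, hWdef, Matrix.mul_assoc Qᵀ, SO_transpose_mul hU, Matrix.mul_one,
      mul_eq_one_comm.1 hQ, Matrix.one_apply_eq]
  have hψ1 : ∀ j, conjEntryCLM W Q j V = Real.cos (θ j) := fun j => by
    rw [conjEntryCLM_apply, hWdef, Matrix.mul_assoc Qᵀ, hV]
  set T := Real.sqrt (∑ i, θ i ^ 2) with hT
  have hTsq : T ^ 2 = ∑ i, θ i ^ 2 := Real.sq_sqrt (Finset.sum_nonneg fun i _ => sq_nonneg _)
  have hcal : ∀ r ∈ Ioo (0 : ℝ) 1,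
      ENNReal.ofReal |(∑ j, θ j * Real.arccos (r * Real.cos (θ j))) -
        ∑ j, θ j * Real.arccos (r * 1)| ≤
      ENNReal.ofReal (T * Real.sqrt 2) * curveLength metricSO c := by
    intro r hr
    have := hc.ofReal_sub_le_curveLength (g := metricSO) (φ := angleCalibration W Q θ r)
      (fun X hX => (angleCalibration_fderiv hW hQ θ hr.1.le hr.2 hX).1)
      (C := T * Real.sqrt 2) (by positivity) (fun t ht v hv =>
        angleCalibration_fderiv_le hW hQ (fun i => (hθ i).1) hr.1.le hr.2
          (hc.2 t (Ioo_subset_Icc_self ht)) (tangent_SO hc.2 ht hv))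
    simpa only [angleCalibration, h0, h1, hψ0, hψ1] using this
  -- Let `r` tend to `1`.
  have hlim : Filter.Tendsto (fun r : ℝ =>
      ENNReal.ofReal |(∑ j, θ j * Real.arccos (r * Real.cos (θ j))) -
        ∑ j, θ j * Real.arccos (r * 1)|) (nhdsWithin 1 (Iio 1))
      (nhds (ENNReal.ofReal |(∑ j, θ j * Real.arccos (1 * Real.cos (θ j))) -
        ∑ j, θ j * Real.arccos (1 * 1)|)) := by
    refine ENNReal.tendsto_ofReal (Filter.Tendsto.mono_left ?_ nhdsWithin_le_nhds)
    refine Continuous.tendsto (f := fun r : ℝ =>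
      |(∑ j, θ j * Real.arccos (r * Real.cos (θ j))) - ∑ j, θ j * Real.arccos (r * 1)|) ?_ 1
    have := Real.continuous_arccos
    fun_prop
  have hle := le_of_tendsto hlim (Filter.eventually_of_mem (Ioo_mem_nhdsLT zero_lt_one) hcal)
  have hval : (∑ j, θ j * Real.arccos (1 * Real.cos (θ j))) - ∑ j, θ j * Real.arccos (1 * 1)
      = T ^ 2 := by
    rw [hTsq, mul_one, Real.arccos_one]
    simp only [one_mul, mul_zero, Finset.sum_const_zero, sub_zero]
    exact Finset.sum_congr rfl fun j _ => by rw [Real.arccos_cos (hθ j).1 (hθ j).2, sq]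
  rw [hval, abs_of_nonneg (sq_nonneg T)] at hle
  rw [← hTsq, Real.sqrt_mul (by norm_num), Real.sqrt_sq (Real.sqrt_nonneg _)]
  rcases (show 0 ≤ T from Real.sqrt_nonneg _).eq_or_lt with hT0 | hT0
  · rw [← hT, ← hT0]
    simp
  · have hC : 0 < T * Real.sqrt 2 := by positivity
    have hfac : T ^ 2 = (T * Real.sqrt 2) * (Real.sqrt (1 / 2) * T) := by
      have : Real.sqrt 2 * Real.sqrt (1 / 2) = 1 := by
        rw [← Real.sqrt_mul zero_le_two]
        norm_num
      linear_combination (-T ^ 2) * this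
    rw [hfac, ENNReal.ofReal_mul hC.le] at hle
    exact (ENNReal.mul_le_mul_iff_right (by simpa using hC) ENNReal.ofReal_ne_top).1 hle

/-- The rotations with given end points that turn every invariant plane at constant speed have the
least possible length. -/
theorem exists_minimal_curve_SO {U V : Mat p} (hU : U ∈ SO p) (hV : V ∈ SO p) :
    ∃ (c : ℝ → Mat p) (a : ℝ), ContDiff ℝ ∞ c ∧ (∀ t, c t ∈ SO p) ∧ c 0 = U ∧ c 1 = V ∧ 0 ≤ a ∧
      (∀ t, metricSO (c t) (deriv c t) (deriv c t) = a ^ 2) ∧ dSO U V = ENNReal.ofReal a := by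
  obtain ⟨Q, θ, N, hQ, had, hθ, hrot, hcos⟩ := exists_frame (SO_mul (SO_transpose hU) hV)
  have hQ' := mul_eq_one_comm.1 hQ
  let φ : Mat p →L[ℝ] Mat p := (LinearMap.mulRight ℝ Qᵀ ∘ₗ
    LinearMap.mulLeft ℝ (U * Q)).toContinuousLinearMap
  have hφ : ∀ X, φ X = U * Q * X * Qᵀ := fun X => rfl
  set c : ℝ → Mat p := fun t => φ (rot θ N t) with hc
  have hcont : ContDiff ℝ ∞ c := φ.contDiff.comp (rot_contDiff θ N)
  have hmem : ∀ t, c t ∈ SO p := by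
    intro t
    have hQdet : Q.det * Qᵀ.det = 1 := by rw [← Matrix.det_mul, hQ, Matrix.det_one]
    have hr := had.rot_mem_SO t
    refine mem_SO.2 ⟨?_, ?_⟩
    · simp only [hc, hφ, Matrix.transpose_mul, Matrix.transpose_transpose]
      calc U * Q * rot θ N t * Qᵀ * (Q * ((rot θ N t)ᵀ * (Qᵀ * Uᵀ)))
          = U * Q * rot θ N t * (Qᵀ * Q) * (rot θ N t)ᵀ * Qᵀ * Uᵀ := by noncomm_ring
        _ = U * Q * (rot θ N t * (rot θ N t)ᵀ) * Qᵀ * Uᵀ := by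
          rw [hQ', Matrix.mul_one]; noncomm_ring
        _ = U * (Q * Qᵀ) * Uᵀ := by rw [SO_mul_transpose hr, Matrix.mul_one]; noncomm_ring
        _ = 1 := by rw [hQ, Matrix.mul_one, SO_mul_transpose hU]
    · simp only [hc, hφ, Matrix.det_mul, (mem_SO.1 hU).2, (mem_SO.1 hr).2, one_mul, mul_one, hQdet]
  have hspeed : ∀ t, metricSO (c t) (deriv c t) (deriv c t) = (1 / 2) * ∑ i, θ i ^ 2 := by
    intro t
    have hd : deriv c t = c t * (Q * (Matrix.diagonal θ * N) * Qᵀ) := by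
      have hd' : HasDerivAt c (φ (rot θ N t * (Matrix.diagonal θ * N))) t :=
        φ.hasFDerivAt.comp_hasDerivAt t (had.hasDerivAt_rot t)
      refine hd'.deriv.trans ?_
      calc U * Q * (rot θ N t * (Matrix.diagonal θ * N)) * Qᵀ
          = U * Q * rot θ N t * 1 * (Matrix.diagonal θ * N) * Qᵀ := by
            rw [Matrix.mul_one]; noncomm_ring
        _ = U * Q * rot θ N t * Qᵀ * (Q * (Matrix.diagonal θ * N) * Qᵀ) := by
          rw [← hQ']; noncomm_ring
    have hinv : (c t)⁻¹ * deriv c t = Q * (Matrix.diagonal θ * N) * Qᵀ := by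
      rw [hd, SO_inv (hmem t), ← Matrix.mul_assoc, SO_transpose_mul (hmem t), Matrix.one_mul]
    have hsq : Q * (Matrix.diagonal θ * N) * Qᵀ * (Q * (Matrix.diagonal θ * N) * Qᵀ) =
        Q * ((Matrix.diagonal θ * N) * (Matrix.diagonal θ * N)) * Qᵀ := by
      calc _ = Q * (Matrix.diagonal θ * N) * (Qᵀ * Q) * (Matrix.diagonal θ * N) * Qᵀ := by
            noncomm_ring
        _ = _ := by rw [hQ', Matrix.mul_one]; noncomm_ring
    rw [metricSO, hinv, hsq, Matrix.trace_mul_comm, ← Matrix.mul_assoc, hQ', Matrix.one_mul,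
      had.trace_generator_sq]
    ring
  have h0 : c 0 = U := by
    simp only [hc, hφ]
    rw [IsAdapted.rot_zero, Matrix.mul_one, Matrix.mul_assoc, hQ, Matrix.mul_one]
  have h1 : c 1 = V := by
    simp only [hc, hφ]
    rw [← hrot]
    calc U * Q * (Qᵀ * (Uᵀ * V) * Q) * Qᵀ = U * (Q * Qᵀ) * Uᵀ * V * (Q * Qᵀ) := by noncomm_ring
      _ = V := by rw [hQ, Matrix.mul_one, Matrix.mul_one, SO_mul_transpose hU, Matrix.one_mul]
  have hnn : 0 ≤ (1 / 2) * ∑ i, θ i ^ 2 := by positivity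
  refine ⟨c, Real.sqrt ((1 / 2) * ∑ i, θ i ^ 2), hcont, hmem, h0, h1, Real.sqrt_nonneg _,
    fun t => by rw [hspeed, Real.sq_sqrt hnn], le_antisymm ?_ ?_⟩
  · rw [← curveLength_of_constant_speed hspeed]
    exact iInf₂_le c ⟨CurveIn.of_contDiff hcont hmem, h0, h1⟩
  · exact le_iInf₂ fun γ hγ => le_curveLength_SO hQ hU hθ hcos hγ.1 hγ.2.1 hγ.2.2

/-- Right translations do not increase the distance of `SO(p)`. -/
lemma dSO_mul_right_le {U V Z : Mat p} (hZ : Z ∈ SO p) : dSO (U * Z) (V * Z) ≤ dSO U V := by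
  refine le_iInf₂ fun c ⟨hc, h0, h1⟩ => ?_
  let φ : Mat p →L[ℝ] Mat p := (LinearMap.mulRight ℝ Z).toContinuousLinearMap
  have hφ : ∀ X, φ X = X * Z := fun X => rfl
  have hcomp : CurveIn (SO p) (φ ∘ c) :=
    ⟨hc.comp fun _ _ => φ.contDiff.contDiffAt, fun t ht => SO_mul (hc.2 t ht) hZ⟩
  refine (iInf₂_le (φ ∘ c) ⟨hcomp, by simp [hφ, h0], by simp [hφ, h1]⟩).trans ?_
  have := hc.curveLength_comp_le (g := metricSO) (h := metricSO) φ zero_le_one (fun t ht v hv => ?_)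
  · rw [ENNReal.ofReal_one, one_mul] at this
    exact this
  · rw [one_mul]
    refine le_of_eq (congrArg _ ?_)
    change metricSO (c t * Z) (v * Z) (v * Z) = metricSO (c t) v v
    rw [metricSO, metricSO, Matrix.mul_inv_rev, SO_inv hZ]
    congr 1
    calc (Zᵀ * (c t)⁻¹ * (v * Z) * (Zᵀ * (c t)⁻¹ * (v * Z))).trace
        = (Zᵀ * ((c t)⁻¹ * v * (Z * Zᵀ) * ((c t)⁻¹ * v) * Z)).trace := by
          congr 1; noncomm_ring
      _ = _ := by
        rw [SO_mul_transpose hZ, Matrix.mul_one, Matrix.trace_mul_comm, Matrix.mul_assoc,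
          SO_mul_transpose hZ, Matrix.mul_one]

end SODistance

/-! ### Lengths in `M(p)` -/

section MDistance

variable {p : ℕ} {k : ℝ} {γ : ℝ → Mat p × Mat p}

lemma metricSO_nonneg {U A : Mat p} (hU : U ∈ SO p) (hA : Aᵀ * U + Uᵀ * A = 0) :
    0 ≤ metricSO U A A := by
  rw [metricSO_eq_sum hU hA]
  positivity

lemma metricDiag_nonneg {D L : Mat p} (hD : D ∈ DiagPos p) (hL : L.IsDiag) :
    0 ≤ metricDiag D L L := by
  rw [metricDiag_eq_sum hD hL]
  positivity

lemma tangent_M (hγ : CurveIn (M p) γ) {t : ℝ} (ht : t ∈ Ioo (0 : ℝ) 1) {v : Mat p × Mat p}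
    (hv : HasDerivAt γ v t) : v.1ᵀ * (γ t).1 + (γ t).1ᵀ * v.1 = 0 ∧ v.2.IsDiag :=
  ⟨tangent_SO (c := fun s => (γ s).1) (fun s hs => (hγ.2 s hs).1) ht
    ((ContinuousLinearMap.fst ℝ (Mat p) (Mat p)).hasFDerivAt.comp_hasDerivAt t hv),
  isDiag_of_hasDerivAt (c := fun s => (γ s).2) (fun s hs => (hγ.2 s hs).2) ht
    ((ContinuousLinearMap.snd ℝ (Mat p) (Mat p)).hasFDerivAt.comp_hasDerivAt t hv)⟩

lemma sqrt_mul_dSO_le_dM (hk : 0 < k) (x y : Mat p × Mat p) :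
    ENNReal.ofReal (Real.sqrt k) * dSO x.1 y.1 ≤ dM k x y := by
  refine le_iInf₂ fun γ ⟨hγ, h0, h1⟩ => ?_
  let φ := ContinuousLinearMap.fst ℝ (Mat p) (Mat p)
  have hcomp : CurveIn (SO p) (φ ∘ γ) :=
    ⟨hγ.comp fun _ _ => φ.contDiff.contDiffAt, fun t ht => (hγ.2 t ht).1⟩
  have hle : dSO x.1 y.1 ≤ curveLength metricSO (φ ∘ γ) :=
    iInf₂_le (φ ∘ γ) ⟨hcomp, congrArg Prod.fst h0, congrArg Prod.fst h1⟩
  refine (mul_le_mul_right hle _).trans ?_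
  refine hγ.curveLength_comp_le (g := metricM k) (h := metricSO) φ (Real.sqrt_nonneg k)
    fun t ht v hv => ?_
  have htan := tangent_M hγ ht hv
  rw [← Real.sqrt_mul hk.le]
  refine Real.sqrt_le_sqrt ?_
  have := metricDiag_nonneg (hγ.2 t (Ioo_subset_Icc_self ht)).2 htan.2
  exact le_add_of_nonneg_right this

/-- The logarithms of the diagonal entries vary at most by the length of the curve. -/
lemma log_sub_le_curveLength (hk : 0 < k) (hγ : CurveIn (M p) γ) (i : Fin p) :
    ENNReal.ofReal |Real.log ((γ 1).2 i i) - Real.log ((γ 0).2 i i)| ≤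
      curveLength (metricM k) γ := by
  let ψ : Mat p × Mat p →L[ℝ] ℝ := entryCLM i i ∘L ContinuousLinearMap.snd ℝ (Mat p) (Mat p)
  have hpos : ∀ x ∈ M p, 0 < ψ x := fun x hx => hx.2.2 i
  have := hγ.ofReal_sub_le_curveLength (g := metricM k) (φ := fun x => Real.log (ψ x))
    (fun x hx => ψ.contDiff.contDiffAt.log (hpos x hx).ne') zero_le_one fun t ht v hv => ?_
  · rw [ENNReal.ofReal_one, one_mul] at this
    exact this
  · have hM := hγ.2 t (Ioo_subset_Icc_self ht)
    have htan := tangent_M hγ ht hv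
    rw [(ψ.hasFDerivAt.log (hpos _ hM).ne').fderiv, one_mul]
    refine Real.abs_le_sqrt ?_
    have h1 : ((γ t).2 i i)⁻¹ * v.2 i i = v.2 i i / (γ t).2 i i := by
      rw [div_eq_mul_inv, mul_comm]
    change (((γ t).2 i i)⁻¹ * v.2 i i) ^ 2 ≤
      k * metricSO (γ t).1 v.1 v.1 + metricDiag (γ t).2 v.2 v.2
    have h2 := mul_nonneg hk.le (metricSO_nonneg hM.1 htan.1)
    have h3 : (v.2 i i / (γ t).2 i i) ^ 2 ≤ metricDiag (γ t).2 v.2 v.2 := by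
      rw [metricDiag_eq_sum hM.2 htan.2]
      exact Finset.single_le_sum (f := fun j => (v.2 j j / (γ t).2 j j) ^ 2)
        (fun j _ => sq_nonneg _) (Finset.mem_univ i)
    rw [h1]
    linarith

end MDistance

/-! ### Fibers over matrices with distinct eigenvalues -/

section Fibers

variable {p : ℕ}

lemma mul_eq_mul_of_mem_fiber {U D : Mat p} (hU : U ∈ SO p) {x : Mat p × Mat p}
    (hx : x ∈ fiber (F (U, D))) : Uᵀ * x.1 * x.2 = D * (Uᵀ * x.1) := by
  have h : x.1 * x.2 * x.1ᵀ = U * D * Uᵀ := hx.2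
  have h1 := SO_transpose_mul hx.1.1
  have h2 := SO_transpose_mul hU
  calc Uᵀ * x.1 * x.2 = Uᵀ * (x.1 * x.2 * (x.1ᵀ * x.1)) := by
        rw [h1, Matrix.mul_one, Matrix.mul_assoc]
    _ = Uᵀ * (x.1 * x.2 * x.1ᵀ) * x.1 := by noncomm_ring
    _ = (Uᵀ * U) * D * Uᵀ * x.1 := by rw [h]; noncomm_ring
    _ = _ := by rw [h2, Matrix.one_mul, Matrix.mul_assoc]

lemma exists_diag_entry_eq {W D D' : Mat p} (hW : W ∈ SO p) (hD : D.IsDiag) (hD' : D'.IsDiag)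
    (h : W * D' = D * W) (i : Fin p) : ∃ j, D' i i = D j j := by
  obtain ⟨d, rfl⟩ : ∃ d, D = Matrix.diagonal d := ⟨_, hD.diagonal_diag.symm⟩
  obtain ⟨d', rfl⟩ : ∃ d', D' = Matrix.diagonal d' := ⟨_, hD'.diagonal_diag.symm⟩
  obtain ⟨j, hj⟩ : ∃ j, W j i ≠ 0 := by
    by_contra! hcon
    have := congrFun (congrFun (SO_transpose_mul hW) i) i
    simp [Matrix.mul_apply, hcon] at this
  refine ⟨j, ?_⟩
  have := congrFun (congrFun h j) i
  rw [Matrix.mul_diagonal, Matrix.diagonal_mul, mul_comm] at this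
  simpa using mul_right_cancel₀ hj this

lemma mem_evenSignChange {S D : Mat p} (hS : S ∈ SO p) (hD : D ∈ DiagTop p)
    (h : D * S = S * D) : S ∈ EvenSignChange p := by
  have hdiag : S.IsDiag := by
    intro i j hij
    obtain ⟨d, rfl⟩ : ∃ d, D = Matrix.diagonal d := ⟨_, hD.1.1.diagonal_diag.symm⟩
    have h1 := congrFun (congrFun h i) j
    rw [Matrix.mul_diagonal, Matrix.diagonal_mul] at h1
    have h2 : d i ≠ d j := fun he => hij (hD.2 (by simpa using he))
    have h3 : (d i - d j) * S i j = 0 := by linarith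
    exact (mul_eq_zero.1 h3).resolve_left (sub_ne_zero.2 h2)
  refine ⟨hS, hdiag, fun i => ?_⟩
  obtain ⟨s, rfl⟩ : ∃ s, S = Matrix.diagonal s := ⟨_, hdiag.diagonal_diag.symm⟩
  have := congrFun (congrFun (SO_mul_transpose hS) i) i
  rw [Matrix.diagonal_transpose, Matrix.diagonal_mul_diagonal, Matrix.diagonal_apply_eq,
    Matrix.one_apply_eq] at this
  rw [Matrix.diagonal_apply_eq]
  exact mul_self_eq_one_iff.1 this

/-- Points of the two fibers with the same diagonal part are, up to a common right translation,
`U` and `V` modified by sign changes. -/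
lemma dSO_le_of_fibers {U V D : Mat p} (hU : U ∈ SO p) (hV : V ∈ SO p) (hD : D ∈ DiagTop p)
    (hUV : ¬SignChangeReducible U V) {x y : Mat p × Mat p} (hx : x ∈ fiber (F (U, D)))
    (hy : y ∈ fiber (F (V, D))) (hxy : x.2 = y.2) : dSO U V ≤ dSO x.1 y.1 := by
  set W := Uᵀ * x.1 with hW
  set Z := Vᵀ * y.1 with hZ
  have hWx : W * x.2 = D * W := mul_eq_mul_of_mem_fiber hU hx
  have hZy : Z * x.2 = D * Z := hxy ▸ mul_eq_mul_of_mem_fiber hV hy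
  have hWSO : W ∈ SO p := SO_mul (SO_transpose hU) hx.1.1
  have hZSO : Z ∈ SO p := SO_mul (SO_transpose hV) hy.1.1
  have hDt : Dᵀ = D := hD.1.1.isSymm
  have hxt : x.2ᵀ = x.2 := hx.1.2.1.isSymm
  have hZt : x.2 * Zᵀ = Zᵀ * D := by
    have := congrArg Matrix.transpose hZy
    rwa [Matrix.transpose_mul Z, Matrix.transpose_mul D, hDt, hxt] at this
  have hS : W * Zᵀ ∈ EvenSignChange p :=
    mem_evenSignChange (SO_mul hWSO (SO_transpose hZSO)) hD (by
      rw [← Matrix.mul_assoc D, ← hWx, Matrix.mul_assoc W, hZt, Matrix.mul_assoc W])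
  have h1 : dSO U V ≤ dSO (U * (W * Zᵀ)) V := not_lt.1 fun h => hUV ⟨_, hS, h⟩
  have h2 : U * (W * Zᵀ) = x.1 * Zᵀ := by
    rw [hW, ← Matrix.mul_assoc, ← Matrix.mul_assoc, SO_mul_transpose hU, Matrix.one_mul]
  have h3 : V = y.1 * Zᵀ := by
    rw [hZ, Matrix.transpose_mul, Matrix.transpose_transpose, ← Matrix.mul_assoc,
      SO_mul_transpose hy.1.1, Matrix.one_mul]
  rw [h2] at h1
  nth_rewrite 2 [h3] at h1
  exact h1.trans (dSO_mul_right_le (SO_transpose hZSO))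

end Fibers

/-! ### Widely separated eigenvalues -/

section Spread

variable {p : ℕ}

/-- The diagonal matrix with entries `exp (s * i)`, whose logarithms are `s` apart. -/
noncomputable def spreadDiag (p : ℕ) (s : ℝ) : Mat p :=
  Matrix.diagonal fun i => Real.exp (s * (i : ℕ))

lemma spreadDiag_apply (s : ℝ) (i : Fin p) : spreadDiag p s i i = Real.exp (s * (i : ℕ)) :=
  Matrix.diagonal_apply_eq _ _

lemma le_abs_log_spreadDiag {s : ℝ} (hs : 0 ≤ s) {i j : Fin p} (hij : i ≠ j) :
    s ≤ |Real.log (spreadDiag p s i i) - Real.log (spreadDiag p s j j)| := by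
  rw [spreadDiag_apply, spreadDiag_apply, Real.log_exp, Real.log_exp, ← mul_sub, abs_mul,
    abs_of_nonneg hs]
  refine le_mul_of_one_le_right hs ?_
  have h : ((i : ℕ) : ℤ) - ((j : ℕ) : ℤ) ≠ 0 := by
    rw [sub_ne_zero]
    exact_mod_cast fun h => hij (Fin.ext h)
  exact_mod_cast Int.one_le_abs h

lemma spreadDiag_mem_DiagTop {s : ℝ} (hs : 0 < s) : spreadDiag p s ∈ DiagTop p := by
  refine ⟨⟨Matrix.isDiag_diagonal _, fun i => ?_⟩, fun i j hij => ?_⟩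
  · rw [spreadDiag_apply]
    exact Real.exp_pos _
  · by_contra hne
    have := le_abs_log_spreadDiag hs.le hne
    simp only at hij
    rw [hij, sub_self, abs_zero] at this
    linarith

end Spread

/-- When the logarithms of the eigenvalues are farther apart than `√k * dSO U V`, it does not pay to
permute them, and the distance of the fibers is the rotational distance of `U` and `V`. -/
lemma sqrt_mul_dSO_le_dSR {p : ℕ} {k s a : ℝ} (hk : 0 < k) {U V : Mat p} (hU : U ∈ SO p)
    (hV : V ∈ SO p) (hUV : ¬SignChangeReducible U V) (ha : dSO U V = ENNReal.ofReal a)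
    (hs : 0 < s) (has : Real.sqrt k * a ≤ s) :
    ENNReal.ofReal (Real.sqrt k * a) ≤
      dSR k (F (U, spreadDiag p s)) (F (V, spreadDiag p s)) := by
  have hD := spreadDiag_mem_DiagTop (p := p) hs
  refine le_iInf₂ fun x hx => le_iInf₂ fun y hy => ?_
  by_cases hxy : x.2 = y.2
  · have h := dSO_le_of_fibers hU hV hD hUV hx hy hxy
    rw [ENNReal.ofReal_mul (Real.sqrt_nonneg k), ← ha]
    exact (mul_le_mul_right h _).trans (sqrt_mul_dSO_le_dM hk x y)
  · obtain ⟨i, hi⟩ : ∃ i, x.2 i i ≠ y.2 i i := by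
      by_contra! hcon
      refine hxy ?_
      ext i j
      by_cases hij : i = j
      · rw [← hij, hcon]
      · rw [hx.1.2.1 hij, hy.1.2.1 hij]
    obtain ⟨j, hj⟩ := exists_diag_entry_eq (SO_mul (SO_transpose hU) hx.1.1) hD.1.1 hx.1.2.1
      (mul_eq_mul_of_mem_fiber hU hx) i
    obtain ⟨l, hl⟩ := exists_diag_entry_eq (SO_mul (SO_transpose hV) hy.1.1) hD.1.1 hy.1.2.1
      (mul_eq_mul_of_mem_fiber hV hy) i
    have hlj : l ≠ j := fun h => hi (by rw [hj, hl, h])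
    refine le_iInf₂ fun γ ⟨hγ, h0, h1⟩ => ?_
    refine le_trans (ENNReal.ofReal_le_ofReal ?_) (log_sub_le_curveLength hk hγ i)
    rw [h0, h1, hj, hl]
    exact has.trans (le_abs_log_spreadDiag hs.le hlj)

end ScalingRotation

theorem mainTheorem4 (p : ℕ) (k : ℝ) (hk : 0 < k) (U V : Matrix (Fin p) (Fin p) ℝ)
    (hU : U ∈ ScalingRotation.SO p) (hV : V ∈ ScalingRotation.SO p)
    (hUV : ¬ ScalingRotation.SignChangeReducible U V) :
    ∃ D Λ : Matrix (Fin p) (Fin p) ℝ,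
      D ∈ ScalingRotation.DiagTop p ∧ Λ ∈ ScalingRotation.DiagTop p ∧
      ScalingRotation.IsMinimalPair k (U, D) (V, Λ) ∧
      ∀ π : Equiv.Perm (Fin p), π ≠ 1 → ∀ V' ∈ ScalingRotation.SO p,
        ScalingRotation.F (V', ScalingRotation.permAct π Λ) = ScalingRotation.F (V, Λ) →
        ¬ ScalingRotation.IsMinimalPair k (U, D) (V', ScalingRotation.permAct π Λ) := by
  open ScalingRotation in
  obtain ⟨c, a, hc, hmem, h0, h1, ha, hspeed, hdist⟩ := exists_minimal_curve_SO hU hV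
  set s : ℝ := Real.sqrt k * a + 1 with hs
  have hka : 0 ≤ Real.sqrt k * a := mul_nonneg (Real.sqrt_nonneg k) ha
  have hs0 : 0 < s := by linarith
  set D : Mat p := spreadDiag p s with hDdef
  have hD : D ∈ DiagTop p := spreadDiag_mem_DiagTop hs0
  -- The minimal geodesic rotates `U` to `V` and keeps `D` fixed.
  set γ : ℝ → Mat p × Mat p := fun t => (c t, D) with hγdef
  have hγ : CurveIn (M p) γ :=
    CurveIn.of_contDiff (hc.prodMk contDiff_const) fun t => ⟨hmem t, hD.1⟩
  have hlen : curveLength (metricM k) γ = ENNReal.ofReal (Real.sqrt k * a) := by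
    have hsq : Real.sqrt k * a = Real.sqrt (k * a ^ 2) := by
      rw [Real.sqrt_mul hk.le, Real.sqrt_sq ha]
    rw [hsq]
    refine curveLength_of_constant_speed fun t => ?_
    have hd : deriv γ t = (deriv c t, 0) :=
      (((hc.differentiable (by simp)) t).hasDerivAt.prodMk (hasDerivAt_const t D)).deriv
    refine (congrArg (fun v => metricM k (γ t) v v) hd).trans ?_
    simp only [metricM, hγdef, hspeed, metricDiag]
    simp
  have hγ0 : γ 0 = (U, D) := by rw [hγdef]; simp only [h0]
  have hγ1 : γ 1 = (V, D) := by rw [hγdef]; simp only [h1]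
  have hfU : (U, D) ∈ fiber (F (U, D)) := ⟨⟨hU, hD.1⟩, rfl⟩
  have hfV : (V, D) ∈ fiber (F (V, D)) := ⟨⟨hV, hD.1⟩, rfl⟩
  have hSR : dSR k (F (U, D)) (F (V, D)) = ENNReal.ofReal (Real.sqrt k * a) := by
    refine le_antisymm ?_ (sqrt_mul_dSO_le_dSR hk hU hV hUV hdist hs0 (by linarith))
    rw [← hlen]
    exact (iInf₂_le _ hfU).trans ((iInf₂_le _ hfV).trans (iInf₂_le γ ⟨hγ, hγ0, hγ1⟩))
  refine ⟨D, D, hD, hD, ⟨hfU.1, hfV.1, γ, ⟨hγ, hγ0 ▸ hfU, hγ1 ▸ hfV, hlen.trans hSR.symm⟩,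
    hγ0, hγ1⟩, ?_⟩
  rintro π hπ V' hV' hF ⟨-, -, δ, ⟨hδ, -, -, hδlen⟩, hδ0, hδ1⟩
  -- A nontrivial permutation moves some eigenvalue, which alone costs more than the distance.
  obtain ⟨j, hj⟩ : ∃ j, π j ≠ j := by
    by_contra! hcon
    exact hπ (Equiv.ext hcon)
  have hlow := log_sub_le_curveLength hk hδ (π j)
  rw [hδlen, hF, hSR, hδ0, hδ1] at hlow
  have hentry : permAct π D (π j) (π j) = D j j := by simp [permAct]
  simp only [hentry] at hlow
  have hlow' := (ENNReal.ofReal_le_ofReal_iff hka).1 hlow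
  linarith [le_abs_log_spreadDiag hs0.le (Ne.symm hj)]
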